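/- Let $\mathcal A$ be a complete abelian category with exact products. For a small category $\mathcal C$, let $\Delta/\mathcal C$ be its simplex category: objects are pairs $([n],f)$ with $f:[n]\to\mathcal C$ a functor, and morphisms $([n],f)\to([m],g)$ are the morphisms $\sigma:[n]\to[m]$ of $\Delta$ with $f=g\circ\sigma$. For a functor $T:\Delta/\mathcal C\to\mathcal A$ (a Thomason natural system), the Thomason cohomology $H^n_{Th}(\mathcal C,T)$ is the $n$-th cohomology of the cochain complex $$C^n_{Th}(\mathcal C,T)=\prod_{[n]\xrightarrow{f}\mathcal C}T(f),\qquad d=\sum_{i=0}^{n+1}(-1)^i d_i,$$ where the component of $d_i$ at $g:[n+1]\to\mathcal C$ is the projection onto the factor $T(g\circ\delta^i)$ followed by $(\delta^i)_*:T(g\circ\delta^i)\to T(g)$. Let $\overline{\mathrm{Hom}}_{\Delta/\mathcal C}(-,T):\mathrm{Fun}(\Delta/\mathcal C,\mathfrak{Ab})^{op}\to\mathcal A$ be the symbolic hom functor, i.e. the right adjoint of $A\mapsto \mathrm{Hom}_{\mathcal A}(A,T(-))$, and let $\mathrm{Ext}^n_{\Delta/\mathcal C}(-,T)$ be its derived functors,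 so that $\mathrm{Ext}^n_{\Delta/\mathcal C}(\underline{\mathbb Z},T)=H^n\bigl(\overline{\mathrm{Hom}}_{\Delta/\mathcal C}(P_*,T)\bigr)$ for a projective resolution $P_*$ of the constant functor $\underline{\mathbb Z}$. Let $\lim^n_{\Delta/\mathcal C}$, also written $H^n(\Delta/\mathcal C,-)$, be the right derived functors (right satellites) of $\lim_{\Delta/\mathcal C}:\mathrm{Fun}(\Delta/\mathcal C,\mathcal A)\to\mathcal A$, i.e. the universal cohomological $\delta$-functor with degree-zero part $\lim_{\Delta/\mathcal C}$. Then the derived limits $\lim^n_{\Delta/\mathcal C}$ exist for every small category $\mathcal C$, and for every $n\ge 0$ there are isomorphisms, natural in $\mathcal C$ and in $T:\Delta/\mathcal C\to\mathcal A$, $$H^n_{Th}(\mathcal C,T)\;\cong\;\mathrm{Ext}^n_{\Delta/\mathcal C}(\underline{\mathbb Z},T)\;\cong\;{\lim}^n_{\Delta/\mathcal C}T=H^n(\Delta/\mathcal C,T).$$ Here naturality in $\mathcal C$ and $T$ means naturality on the category whose objects are the pairs $(\mathcal C,T)$ and whose morphisms $(\mathcal C_1,T_1)\to(\mathcal C_2,T_2)$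 are the pairs $(\varphi,\tau)$ of a functor $\varphi:\mathcal C_2\to\mathcal C_1$ and a natural transformation $\tau:T_1\circ\Delta/\varphi\to T_2$. -/

import Mathlib

open CategoryTheory CategoryTheory.Limits Opposite

attribute [-instance] CategoryTheory.catToReflQuiver

universe w u v₁ v₂ v₃ u₁ u₂ u₃

noncomputable section

namespace Thomason

/-! ### The simplex category and Thomason natural systems -/

/-- Objects of the simplex category `Δ/C`: pairs `([n], f)` with `f : [n] ⥤ C` a functor. -/
structure SimplexCat (C : Type w) [SmallCategory C] : Type w where
  dim : SimplexCategory
  simplex : Fin (dim.len + 1) ⥤ C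

section SimplexCat

variable {C : Type w} [SmallCategory C]

/-- A morphism `σ : [n] ⟶ [m]` of the standard simplex category, regarded as a functor. -/
def toFunctor {n m : SimplexCategory} (σ : n ⟶ m) : Fin (n.len + 1) ⥤ Fin (m.len + 1) :=
  σ.toOrderHom.monotone.functor

/-- A morphism `([n], f) ⟶ ([m], g)` in `Δ/C`: a morphism `σ : [n] ⟶ [m]` with `f = g ∘ σ`. -/
@[ext]
structure SimplexCat.Hom (f g : SimplexCat C) : Type w where
  map : f.dim ⟶ g.dim
  comm : f.simplex = toFunctor map ⋙ g.simplex

instance : SmallCategory (SimplexCat C) where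
  Hom f g := SimplexCat.Hom f g
  id f := ⟨𝟙 f.dim, rfl⟩
  comp {f g h} a b := ⟨a.map ≫ b.map, by rw [a.comm, b.comm]; rfl⟩

@[ext]
theorem SimplexCat.hom_ext {f g : SimplexCat C} {a b : f ⟶ g} (h : a.map = b.map) : a = b :=
  SimplexCat.Hom.ext h

@[simp]
theorem SimplexCat.id_map (f : SimplexCat C) : SimplexCat.Hom.map (𝟙 f) = 𝟙 f.dim := rfl

@[simp]
theorem SimplexCat.comp_map {f g h : SimplexCat C} (a : f ⟶ g) (b : g ⟶ h) :
    (a ≫ b).map = a.map ≫ b.map := rfl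

/-- The morphism `([n], g ∘ σ) ⟶ ([m], g)` of `Δ/C` given by `σ : [n] ⟶ [m]`. -/
def SimplexCat.pull {n m : SimplexCategory} (σ : n ⟶ m) (g : Fin (m.len + 1) ⥤ C) :
    (⟨n, toFunctor σ ⋙ g⟩ : SimplexCat C) ⟶ ⟨m, g⟩ :=
  SimplexCat.Hom.mk σ rfl

/-- The functor `Δ/φ : Δ/C ⥤ Δ/D` induced by a functor `φ : C ⥤ D`, `f ↦ φ ∘ f`. -/
def SimplexCat.mapFunctor {D : Type w} [SmallCategory D] (φ : C ⥤ D) :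
    SimplexCat C ⥤ SimplexCat D where
  obj f := ⟨f.dim, f.simplex ⋙ φ⟩
  map {f g} a := SimplexCat.Hom.mk a.map (by rw [a.comm]; rfl)

end SimplexCat

/-- A Thomason natural system with values in `A`: a small category `C` together with a functor
`T : Δ/C ⥤ A`. These are the objects of the category of Thomason natural systems. -/
structure NatSystem (A : Type u) [Category.{w} A] : Type (max u (w + 1)) where
  base : Type w
  [cat : SmallCategory base]
  system : SimplexCat base ⥤ A

attribute [instance] NatSystem.cat

/-- A morphism `(φ, τ) : T₁ ⟶ T₂` of Thomason natural systems: a functor `φ : C₂ ⥤ C₁` and a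
natural transformation `τ : T₁ ∘ Δ/φ ⟶ T₂`. -/
structure NatSystem.Hom {A : Type u} [Category.{w} A] (S T : NatSystem A) : Type w where
  functor : T.base ⥤ S.base
  trans : SimplexCat.mapFunctor functor ⋙ S.system ⟶ T.system

instance (A : Type u) [Category.{w} A] : Category.{w} (NatSystem A) where
  Hom S T := NatSystem.Hom S T
  id S := ⟨𝟭 S.base,
    { app := fun f => 𝟙 (S.system.obj f)
      naturality := fun _ _ x => (Category.comp_id _).trans (Category.id_comp (S.system.map x)).symm }⟩
  comp {R S T} a b := ⟨b.functor ⋙ a.functor,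
    { app := fun f => a.trans.app ((SimplexCat.mapFunctor b.functor).obj f) ≫ b.trans.app f
      naturality := fun f g x => (Functor.whiskerLeft (SimplexCat.mapFunctor b.functor) a.trans ≫
        b.trans).naturality x }⟩
  id_comp a := by
    refine congrArg (NatSystem.Hom.mk a.functor) (NatTrans.ext (funext fun f => ?_))
    exact Category.id_comp _
  comp_id a := by
    refine congrArg (NatSystem.Hom.mk a.functor) (NatTrans.ext (funext fun f => ?_))
    exact Category.comp_id _
  assoc a b c := by
    refine congrArg (NatSystem.Hom.mk (c.functor ⋙ b.functor ⋙ a.functor))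
      (NatTrans.ext (funext fun f => ?_))
    exact Category.assoc _ _ _

section NatSystem

variable {A : Type u} [Category.{w} A]

@[simp]
theorem NatSystem.id_functor (S : NatSystem A) : NatSystem.Hom.functor (𝟙 S) = 𝟭 S.base := rfl

@[simp]
theorem NatSystem.comp_functor {R S T : NatSystem A} (a : R ⟶ S) (b : S ⟶ T) :
    (a ≫ b).functor = b.functor ⋙ a.functor := rfl

/-- The component `τ_g : T₁ (φ ∘ g) ⟶ T₂ g` of a morphism `(φ, τ)` at `g : [n] ⥤ C₂`. -/
def NatSystem.Hom.at {S T : NatSystem A} (a : S ⟶ T) {n : SimplexCategory}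
    (g : Fin (n.len + 1) ⥤ T.base) :
    S.system.obj ⟨n, g ⋙ a.functor⟩ ⟶ T.system.obj ⟨n, g⟩ :=
  a.trans.app ⟨n, g⟩

theorem NatSystem.Hom.at_naturality {S T : NatSystem A} (a : S ⟶ T) {n m : SimplexCategory}
    (σ : n ⟶ m) (g : Fin (m.len + 1) ⥤ T.base) :
    S.system.map (SimplexCat.pull σ (g ⋙ a.functor)) ≫ a.at g =
      a.at (toFunctor σ ⋙ g) ≫ T.system.map (SimplexCat.pull σ g) :=
  a.trans.naturality (SimplexCat.pull σ g)

theorem NatSystem.id_at (S : NatSystem A) {n : SimplexCategory} (g : Fin (n.len + 1) ⥤ S.base) :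
    NatSystem.Hom.at (𝟙 S) g = 𝟙 (S.system.obj ⟨n, g⟩) := rfl

theorem NatSystem.comp_at {R S T : NatSystem A} (a : R ⟶ S) (b : S ⟶ T) {n : SimplexCategory}
    (g : Fin (n.len + 1) ⥤ T.base) :
    NatSystem.Hom.at (a ≫ b) g = a.at (g ⋙ b.functor) ≫ b.at g := rfl

end NatSystem

/-! ### Thomason cohomology -/

section Thomason

variable {A : Type u} [Category.{w} A] [HasProducts.{w} A]

/-- The cosimplicial replacement `∏^* T` of a Thomason natural system `T : Δ/C ⥤ A`. For
`σ : [n] ⟶ [m]`, the component of the structure map at `g : [m] ⥤ C` is the projection onto the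
component at `g ∘ σ` followed by `σ_* : T (g ∘ σ) ⟶ T g`. -/
def cosimplicialReplacement {C : Type w} [SmallCategory C] (T : SimplexCat C ⥤ A) :
    CosimplicialObject A where
  obj n := ∏ᶜ fun f : Fin (n.len + 1) ⥤ C => T.obj ⟨n, f⟩
  map {n m} σ := Pi.lift fun g => Pi.π (fun f : Fin (n.len + 1) ⥤ C => T.obj ⟨n, f⟩)
    (toFunctor σ ⋙ g) ≫ T.map (SimplexCat.pull σ g)
  map_id n := by
    refine Pi.hom_ext _ _ fun g => ?_
    rw [Pi.lift_π, Category.id_comp]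
    exact (congrArg (_ ≫ ·) (T.map_id (⟨n, g⟩ : SimplexCat C))).trans (Category.comp_id _)
  map_comp {n m k} σ ρ := by
    refine Pi.hom_ext _ _ fun g => ?_
    rw [Pi.lift_π, Category.assoc, Pi.lift_π, Pi.lift_π_assoc, Category.assoc]
    refine congrArg (_ ≫ ·) ?_
    rw [← T.map_comp]
    rfl

/-- The cosimplicial replacement is functorial on the category of Thomason natural systems:
`(φ, τ)` acts by `(a_f)_f ↦ (τ_g (a_{φ ∘ g}))_g`. -/
def cosimplicialReplacementFunctor (A : Type u) [Category.{w} A] [HasProducts.{w} A] :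
    NatSystem A ⥤ CosimplicialObject A where
  obj S := cosimplicialReplacement S.system
  map {S T} a :=
    { app := fun n => Pi.lift fun g : Fin (n.len + 1) ⥤ T.base =>
        Pi.π (fun f : Fin (n.len + 1) ⥤ S.base => S.system.obj ⟨n, f⟩) (g ⋙ a.functor) ≫ a.at g
      naturality := fun n m σ => by
        refine Pi.hom_ext _ _ fun g => ?_
        have h := a.at_naturality σ g
        dsimp only [cosimplicialReplacement]
        rw [Category.assoc, Pi.lift_π, Pi.lift_π_assoc, Category.assoc, Category.assoc, Pi.lift_π,
          Pi.lift_π_assoc, Category.assoc]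
        exact congrArg (_ ≫ ·) h }
  map_id S := by
    ext n
    refine Pi.hom_ext _ _ fun g => ?_
    refine (Pi.lift_π _ _).trans ?_
    exact (Category.comp_id _).trans (Category.id_comp _).symm
  map_comp {R S T} a b := by
    ext n
    refine Pi.hom_ext _ _ fun g => ?_
    refine (Pi.lift_π _ _).trans ?_
    symm
    refine (Category.assoc _ _ _).trans ?_
    refine (congrArg (_ ≫ ·) (Pi.lift_π _ _)).trans ?_
    exact ((Category.assoc _ _ _).symm.trans (congrArg (· ≫ _) (Pi.lift_π _ _))).trans
      (Category.assoc _ _ _)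

end Thomason

section Cohomology

variable (A : Type u) [Category.{w} A] [Abelian A] [HasProducts.{w} A]

/-- The Thomason cochain complex `C_Th^*`, as a functor on Thomason natural systems. -/
def thomasonComplex : NatSystem A ⥤ CochainComplex A ℕ :=
  cosimplicialReplacementFunctor A ⋙ AlgebraicTopology.alternatingCofaceMapComplex A

/-- The `n`-th Thomason cohomology `H^n_Th(C, T)`, as a functor on Thomason natural systems. -/
def thomasonCohomology (n : ℕ) : NatSystem A ⥤ A :=
  thomasonComplex A ⋙ HomologicalComplex.homologyFunctor A (ComplexShape.up ℕ) n

/-- The `n`-th Thomason cochain object is the product of the `T f` over all `f : [n] ⥤ C`. -/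
theorem thomasonComplex_X (S : NatSystem A) (n : ℕ) :
    ((thomasonComplex A).obj S).X n =
      ∏ᶜ fun f : Fin (n + 1) ⥤ S.base => S.system.obj ⟨SimplexCategory.mk n, f⟩ := rfl

/-- The differential is `∑ i, (-1)^i d_i` where the component of `d_i` at `g : [n + 1] ⥤ C` is the
projection onto the component at `g ∘ δ^i` followed by `(δ^i)_*`. -/
theorem thomasonComplex_d (S : NatSystem A) (n : ℕ) :
    ((thomasonComplex A).obj S).d n (n + 1) = ∑ i : Fin (n + 2), (-1 : ℤ) ^ (i : ℕ) •
      Pi.lift fun g : Fin (n + 1 + 1) ⥤ S.base =>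
        Pi.π (fun f : Fin (n + 1) ⥤ S.base => S.system.obj ⟨SimplexCategory.mk n, f⟩)
          (toFunctor (SimplexCategory.δ i) ⋙ g) ≫
          S.system.map (SimplexCat.pull (SimplexCategory.δ i) g) :=
  CochainComplex.of_d _ (AlgebraicTopology.AlternatingCofaceMapComplex.objD
    (cosimplicialReplacement S.system)) n

end Cohomology

/-! ### The symbolic Hom functor -/

section SymbolicHom

variable {A : Type u} [Category.{w} A] [Preadditive A]

/-- The functor `X ↦ Hom_A(X, T(-))`, from `A` to `Fun(D, Ab)ᵒᵖ`. -/
def homInto {D : Type w} [SmallCategory D] (T : D ⥤ A) : A ⥤ (D ⥤ AddCommGrpCat.{w})ᵒᵖ where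
  obj X := op
    { obj := fun c => AddCommGrpCat.of (X ⟶ T.obj c)
      map := fun σ => AddCommGrpCat.ofHom
        { toFun := fun x => x ≫ T.map σ
          map_zero' := zero_comp
          map_add' := fun _ _ => Preadditive.add_comp _ _ _ _ _ _ }
      map_id := fun c => by ext x; simp
      map_comp := fun σ ρ => by ext x; simp }
  map {X Y} h := Quiver.Hom.op
    { app := fun c => AddCommGrpCat.ofHom
        { toFun := fun x => h ≫ x
          map_zero' := comp_zero
          map_add' := fun _ _ => Preadditive.comp_add _ _ _ _ _ _ }
      naturality := fun c d σ => by ext x; simp }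
  map_id X := by
    apply Quiver.Hom.unop_inj
    ext c x
    simp
  map_comp h k := by
    apply Quiver.Hom.unop_inj
    ext c x
    simp

variable {D : Type w} [SmallCategory D]

/-- The index set of the equations that single out the natural, additive families. -/
abbrev SymRel (M : D ⥤ AddCommGrpCat.{w}) : Type w :=
  (Σ p : D × D, (p.1 ⟶ p.2) × M.obj p.1) ⊕ (Σ c : D, M.obj c × M.obj c)

section Representing

variable [HasLimits A] (M : D ⥤ AddCommGrpCat.{w}) (T : D ⥤ A)

/-- The target object of an equation. -/
def symTarget : SymRel M → A
  | .inl ⟨p, _⟩ => T.obj p.2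
  | .inr ⟨c, _⟩ => T.obj c

/-- The left-hand sides of the equations. -/
def symLeft : ∀ r : SymRel M, (∏ᶜ fun i : (Σ c : D, M.obj c) => T.obj i.1) ⟶ symTarget M T r
  | .inl ⟨p, s⟩ => Pi.π (fun i : (Σ c : D, M.obj c) => T.obj i.1) ⟨p.2, M.map s.1 s.2⟩
  | .inr ⟨c, s⟩ => Pi.π (fun i : (Σ c : D, M.obj c) => T.obj i.1) ⟨c, s.1 + s.2⟩

/-- The right-hand sides of the equations. -/
def symRight : ∀ r : SymRel M, (∏ᶜ fun i : (Σ c : D, M.obj c) => T.obj i.1) ⟶ symTarget M T r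
  | .inl ⟨p, s⟩ => Pi.π (fun i : (Σ c : D, M.obj c) => T.obj i.1) ⟨p.1, s.2⟩ ≫ T.map s.1
  | .inr ⟨c, s⟩ => Pi.π (fun i : (Σ c : D, M.obj c) => T.obj i.1) ⟨c, s.1⟩ +
      Pi.π (fun i : (Σ c : D, M.obj c) => T.obj i.1) ⟨c, s.2⟩

/-- An object representing the natural additive families. -/
def symRep : A := equalizer (Pi.lift (symLeft M T)) (Pi.lift (symRight M T))

/-- The universal family. -/
def symRepProj (c : D) (x : M.obj c) : symRep M T ⟶ T.obj c :=
  equalizer.ι _ _ ≫ Pi.π (fun i : (Σ c : D, M.obj c) => T.obj i.1) ⟨c, x⟩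

theorem symRep_cond (r : SymRel M) :
    equalizer.ι (Pi.lift (symLeft M T)) (Pi.lift (symRight M T)) ≫ symLeft M T r =
      equalizer.ι (Pi.lift (symLeft M T)) (Pi.lift (symRight M T)) ≫ symRight M T r := by
  have h := equalizer.condition (Pi.lift (symLeft M T)) (Pi.lift (symRight M T)) =≫ Pi.π _ r
  simpa using h

theorem symRepProj_map {c d : D} (s : c ⟶ d) (x : M.obj c) :
    symRepProj M T d (M.map s x) = symRepProj M T c x ≫ T.map s :=
  (symRep_cond M T (.inl ⟨(c, d), s, x⟩)).trans (Category.assoc _ _ _).symm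

theorem symRepProj_add (c : D) (x y : M.obj c) :
    symRepProj M T c (x + y) = symRepProj M T c x + symRepProj M T c y :=
  (symRep_cond M T (.inr ⟨c, x, y⟩)).trans (Preadditive.comp_add _ _ _ _ _ _)

/-- The representability of the natural additive families. -/
def symRepEquiv (X : A) : ((homInto T).obj X ⟶ op M) ≃ (X ⟶ symRep M T) where
  toFun β := equalizer.lift (Pi.lift fun i : (Σ c : D, M.obj c) => (β.unop.app i.1 i.2 : X ⟶ _))
    (by
      refine Pi.hom_ext _ _ fun r => ?_
      rw [Category.assoc, Pi.lift_π, Category.assoc, Pi.lift_π]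
      rcases r with ⟨p, s⟩ | ⟨c, s⟩
      · refine (Pi.lift_π _ _).trans (Eq.trans ?_ (Pi.lift_π_assoc _ _ _).symm)
        exact ConcreteCategory.congr_hom (β.unop.naturality s.1) s.2
      · refine (Pi.lift_π _ _).trans (Eq.trans ?_ (Preadditive.comp_add _ _ _ _ _ _).symm)
        refine Eq.trans ?_ (congrArg₂ (· + ·) (Pi.lift_π _ _) (Pi.lift_π _ _)).symm
        exact map_add (β.unop.app c).hom s.1 s.2)
  invFun h := Quiver.Hom.op
    { app := fun c => AddCommGrpCat.ofHom (AddMonoidHom.mk'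
        (fun x => h ≫ symRepProj M T c x)
        (fun x y => by rw [symRepProj_add, Preadditive.comp_add]))
      naturality := fun c d s => by
        ext x
        exact (congrArg (h ≫ ·) (symRepProj_map M T s x)).trans (Category.assoc _ _ _).symm }
  left_inv β := by
    apply Quiver.Hom.unop_inj
    ext c x
    refine (equalizer.lift_ι_assoc _ _ _).trans (Pi.lift_π _ _)
  right_inv h := by
    refine equalizer.hom_ext (Pi.hom_ext _ _ fun i => ?_)
    rw [equalizer.lift_ι]
    exact (Pi.lift_π _ _).trans (Category.assoc _ _ _).symm

end Representing

instance [HasLimits A] (T : D ⥤ A) : (homInto T).IsLeftAdjoint :=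
  ⟨_, ⟨Adjunction.adjunctionOfEquivRight
    (fun X M => symRepEquiv M.unop T X) (by
      intro X' X M f g
      refine equalizer.hom_ext (Pi.hom_ext _ _ fun i => ?_)
      refine ((congrArg (· ≫ _) (equalizer.lift_ι _ _)).trans (Pi.lift_π _ _)).trans ?_
      refine Eq.symm ((Category.assoc _ _ _).trans ((Category.assoc _ _ _).trans ?_))
      refine congrArg (f ≫ ·) ?_
      exact (Category.assoc _ _ _).symm.trans
        ((congrArg (· ≫ _) (equalizer.lift_ι _ _)).trans (Pi.lift_π _ _)))⟩⟩

variable [HasLimits A]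

/-- The symbolic hom functor `Hom_D(-, T) : Fun(D, Ab)ᵒᵖ ⥤ A`: the right adjoint of
`X ↦ Hom_A(X, T(-))`. -/
def symHom (T : D ⥤ A) : (D ⥤ AddCommGrpCat.{w})ᵒᵖ ⥤ A := (homInto T).rightAdjoint

/-- The adjunction which defines the symbolic hom functor. -/
def symHomAdj (T : D ⥤ A) : homInto T ⊣ symHom T := Adjunction.ofIsLeftAdjoint (homInto T)

/-- Evaluation of the symbolic hom at an element `x ∈ M(c)`: the component of the counit of the
adjunction. -/
def symEval (T : D ⥤ A) (M : D ⥤ AddCommGrpCat.{w}) (c : D) (x : M.obj c) :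
    (symHom T).obj (op M) ⟶ T.obj c :=
  ((symHomAdj T).counit.app (op M)).unop.app c x

/-- The morphism `X ⟶ Hom_D(M, T)` adjoint to a natural transformation `M ⟶ Hom_A(X, T(-))`. -/
def symLift (T : D ⥤ A) (M : D ⥤ AddCommGrpCat.{w}) (X : A) (β : M ⟶ ((homInto T).obj X).unop) :
    X ⟶ (symHom T).obj (op M) :=
  (symHomAdj T).homEquiv X (op M) β.op

theorem symLift_eval (T : D ⥤ A) (M : D ⥤ AddCommGrpCat.{w}) (X : A)
    (β : M ⟶ ((homInto T).obj X).unop) (c : D) (x : M.obj c) :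
    symLift T M X β ≫ symEval T M c x = β.app c x := by
  have h := ((symHomAdj T).homEquiv X (op M)).symm_apply_apply β.op
  rw [Adjunction.homEquiv_counit] at h
  exact congrArg (fun γ : (homInto T).obj X ⟶ op M => γ.unop.app c x) h

theorem symHom_ext (T : D ⥤ A) (M : D ⥤ AddCommGrpCat.{w}) {X : A}
    {f g : X ⟶ (symHom T).obj (op M)}
    (h : ∀ (c : D) (x : M.obj c), f ≫ symEval T M c x = g ≫ symEval T M c x) : f = g := by
  apply ((symHomAdj T).homEquiv X (op M)).symm.injective
  rw [Adjunction.homEquiv_counit, Adjunction.homEquiv_counit]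
  apply Quiver.Hom.unop_inj
  ext c x
  exact h c x

theorem symEval_map (T : D ⥤ A) (M : D ⥤ AddCommGrpCat.{w}) {c d : D} (s : c ⟶ d) (x : M.obj c) :
    symEval T M d (M.map s x) = symEval T M c x ≫ T.map s :=
  ConcreteCategory.congr_hom (((symHomAdj T).counit.app (op M)).unop.naturality s) x

theorem symEval_add (T : D ⥤ A) (M : D ⥤ AddCommGrpCat.{w}) (c : D) (x y : M.obj c) :
    symEval T M c (x + y) = symEval T M c x + symEval T M c y :=
  map_add (((symHomAdj T).counit.app (op M)).unop.app c).hom x y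

theorem symHom_map_eval (T : D ⥤ A) {M N : D ⥤ AddCommGrpCat.{w}} (a : M ⟶ N) (c : D)
    (x : M.obj c) : (symHom T).map a.op ≫ symEval T M c x = symEval T N c (a.app c x) :=
  congrArg (fun γ : (homInto T).obj _ ⟶ op M => γ.unop.app c x)
    ((symHomAdj T).counit.naturality a.op)

instance (T : D ⥤ A) : (symHom T).Additive where
  map_add {M N f g} := by
    refine symHom_ext T N.unop fun c x => ?_
    rw [Preadditive.add_comp]
    refine (symHom_map_eval T (f.unop + g.unop) c x).trans ?_
    refine Eq.trans ?_ (congrArg₂ (· + ·) (symHom_map_eval T f.unop c x)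
      (symHom_map_eval T g.unop c x)).symm
    exact symEval_add T _ c (f.unop.app c x) (g.unop.app c x)

end SymbolicHom

/-! ### Ext groups with values in `A` -/

section EnoughProjectives

variable {D : Type w} [SmallCategory D]

/-- The functor `ℤ Hom_D(c, -) : D ⥤ Ab`. -/
def freeOn (c : D) : D ⥤ AddCommGrpCat.{w} where
  obj d := AddCommGrpCat.of (FreeAbelianGroup (c ⟶ d))
  map s := AddCommGrpCat.ofHom (FreeAbelianGroup.map fun r => r ≫ s)
  map_id d := by
    refine AddCommGrpCat.hom_ext (FreeAbelianGroup.lift_ext _ _ fun r => ?_)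
    simp
  map_comp s t := by
    refine AddCommGrpCat.hom_ext (FreeAbelianGroup.lift_ext _ _ fun r => ?_)
    simp

/-- The natural transformation `ℤ Hom_D(c, -) ⟶ M` determined by an element of `M(c)`. -/
def freeOnDesc (M : D ⥤ AddCommGrpCat.{w}) (c : D) (x : M.obj c) : freeOn c ⟶ M where
  app d := AddCommGrpCat.ofHom (FreeAbelianGroup.lift fun s : c ⟶ d => M.map s x)
  naturality d e s := by
    refine AddCommGrpCat.hom_ext (FreeAbelianGroup.lift_ext _ _ fun r => ?_)
    simp [freeOn]

theorem freeOnDesc_id (M : D ⥤ AddCommGrpCat.{w}) (c : D) (x : M.obj c) :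
    (freeOnDesc M c x).app c (FreeAbelianGroup.of (𝟙 c)) = x := by
  refine (FreeAbelianGroup.lift_apply_of _ _).trans ?_
  simp

theorem freeOn_hom_ext {M : D ⥤ AddCommGrpCat.{w}} {c : D} {a b : freeOn c ⟶ M}
    (h : a.app c (FreeAbelianGroup.of (𝟙 c)) = b.app c (FreeAbelianGroup.of (𝟙 c))) : a = b := by
  refine NatTrans.ext (funext fun d => AddCommGrpCat.hom_ext (FreeAbelianGroup.lift_ext _ _ fun r => ?_))
  have key : ∀ e : freeOn c ⟶ M, e.app d (FreeAbelianGroup.of r) =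
      M.map r (e.app c (FreeAbelianGroup.of (𝟙 c))) := fun e => by
    have h := ConcreteCategory.congr_hom (e.naturality r) (FreeAbelianGroup.of (𝟙 c))
    refine Eq.trans ?_ h
    refine congrArg (e.app d) ?_
    refine Eq.symm ((FreeAbelianGroup.map_of_apply _).trans ?_)
    rw [Category.id_comp]
  exact (key a).trans ((congrArg (M.map r) h).trans (key b).symm)

instance (c : D) : Projective (freeOn c) where
  factors {E X} f e _ := by
    have he : Function.Surjective (e.app c) :=
      (AddCommGrpCat.epi_iff_surjective _).1 inferInstance
    obtain ⟨x, hx⟩ := he (f.app c (FreeAbelianGroup.of (𝟙 c)))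
    refine ⟨freeOnDesc E c x, freeOn_hom_ext ?_⟩
    refine Eq.trans ?_ hx
    exact congrArg (e.app c) (freeOnDesc_id E c x)

instance : EnoughProjectives (D ⥤ AddCommGrpCat.{w}) where
  presentation M := ⟨
    { p := ∐ fun i : (Σ c : D, M.obj c) => freeOn i.1
      f := Sigma.desc fun i => freeOnDesc M i.1 i.2
      projective := inferInstance
      epi := by
        rw [NatTrans.epi_iff_epi_app]
        intro c
        rw [AddCommGrpCat.epi_iff_surjective]
        intro x
        refine ⟨(Sigma.ι (fun i : (Σ c : D, M.obj c) => freeOn i.1) ⟨c, x⟩).app c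
          (FreeAbelianGroup.of (𝟙 c)), ?_⟩
        refine Eq.trans ?_ (freeOnDesc_id M c x)
        have h := Sigma.ι_desc (fun i : (Σ c : D, M.obj c) => freeOnDesc M i.1 i.2) ⟨c, x⟩
        exact congrArg (fun γ : freeOn c ⟶ M => γ.app c (FreeAbelianGroup.of (𝟙 c))) h }⟩

end EnoughProjectives

section Lifting

variable {𝓐 : Type u₁} [Category.{v₁} 𝓐] [Abelian 𝓐]

/-- A chain complex `⋯ ⟶ Q₁ ⟶ Q₀` with an augmentation `Q₀ ⟶ Y` such that the augmented complex
is exact. -/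
structure ExactAug (Y : 𝓐) where
  complex : ChainComplex 𝓐 ℕ
  aug : complex.X 0 ⟶ Y
  w : complex.d 1 0 ≫ aug = 0
  epi : Epi aug
  exact₀ : (ShortComplex.mk _ _ w).Exact
  exact_succ (n : ℕ) : (ShortComplex.mk _ _ (complex.d_comp_d (n + 2) (n + 1) n)).Exact

/-- The augmentation of a projective resolution. -/
def resAug {X : 𝓐} (P : ProjectiveResolution X) : P.complex.X 0 ⟶ X := P.π.f 0

/-- A projective resolution as an exact augmented complex. -/
def ExactAug.ofRes {X : 𝓐} (P : ProjectiveResolution X) : ExactAug X where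
  complex := P.complex
  aug := resAug P
  w := P.complex_d_comp_π_f_zero
  epi := inferInstanceAs (Epi (P.π.f 0))
  exact₀ := P.exact₀
  exact_succ := P.exact_succ

/-- A morphism of chain complexes over a given morphism of the augmented objects. -/
def IsOver {X Y : 𝓐} (P : ProjectiveResolution X) (Q : ExactAug Y) (f : X ⟶ Y)
    (φ : P.complex ⟶ Q.complex) : Prop := φ.f 0 ≫ Q.aug = resAug P ≫ f

theorem exists_isOver {X Y : 𝓐} (P : ProjectiveResolution X) (Q : ExactAug Y) (f : X ⟶ Y) :
    ∃ φ : P.complex ⟶ Q.complex, IsOver P Q f φ := by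
  have := Q.epi
  let z : P.complex.X 0 ⟶ Q.complex.X 0 := Projective.factorThru (resAug P ≫ f) Q.aug
  have hz : z ≫ Q.aug = resAug P ≫ f := Projective.factorThru_comp _ _
  have hP : P.complex.d 1 0 ≫ resAug P = 0 := P.complex_d_comp_π_f_zero
  have h₁ : (P.complex.d 1 0 ≫ z) ≫ Q.aug = 0 := by
    rw [Category.assoc, hz, ← Category.assoc, hP, zero_comp]
  let o : P.complex.X 1 ⟶ Q.complex.X 1 := Q.exact₀.liftFromProjective (P.complex.d 1 0 ≫ z) h₁
  have ho : o ≫ Q.complex.d 1 0 = P.complex.d 1 0 ≫ z :=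
    Q.exact₀.liftFromProjective_comp (P.complex.d 1 0 ≫ z) h₁
  refine ⟨ChainComplex.mkHom _ _ z o ho fun n ⟨g, g', h⟩ =>
    ⟨(Q.exact_succ n).liftFromProjective (P.complex.d (n + 2) (n + 1) ≫ g') (by
      dsimp only
      rw [Category.assoc, h, ← Category.assoc, P.complex.d_comp_d, zero_comp]),
      (Q.exact_succ n).liftFromProjective_comp _ _⟩, ?_⟩
  refine Eq.trans ?_ hz
  exact congrArg (· ≫ Q.aug) (ChainComplex.mkHom_f_0 ..)

theorem nonempty_homotopy_zero {X Y : 𝓐} (P : ProjectiveResolution X) (Q : ExactAug Y)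
    (φ : P.complex ⟶ Q.complex) (h : φ.f 0 ≫ Q.aug = 0) : Nonempty (Homotopy φ 0) := by
  let z : P.complex.X 0 ⟶ Q.complex.X 1 := Q.exact₀.liftFromProjective (φ.f 0) h
  have hz : φ.f 0 = z ≫ Q.complex.d 1 0 := (Q.exact₀.liftFromProjective_comp (φ.f 0) h).symm
  have h₁ : (φ.f 1 - P.complex.d 1 0 ≫ z) ≫ Q.complex.d 1 0 = 0 := by
    rw [Preadditive.sub_comp, Category.assoc, ← hz, HomologicalComplex.Hom.comm, sub_self]
  let o : P.complex.X 1 ⟶ Q.complex.X 2 := (Q.exact_succ 0).liftFromProjective _ h₁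
  have ho : o ≫ Q.complex.d 2 1 = φ.f 1 - P.complex.d 1 0 ≫ z :=
    (Q.exact_succ 0).liftFromProjective_comp _ h₁
  exact ⟨Homotopy.mkInductive _ z hz o (by rw [ho]; abel) fun n ⟨g, g', hg⟩ =>
    ⟨(Q.exact_succ (n + 1)).liftFromProjective (φ.f (n + 2) - P.complex.d _ _ ≫ g') (by
      dsimp only
      rw [Preadditive.sub_comp, HomologicalComplex.Hom.comm, hg, Category.assoc,
        Preadditive.comp_add, ← Category.assoc, P.complex.d_comp_d, zero_comp, zero_add, sub_self]),
      by
        refine (sub_eq_iff_eq_add'.1 ?_)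
        exact ((Q.exact_succ (n + 1)).liftFromProjective_comp _ _).symm⟩⟩

theorem IsOver.nonempty_homotopy {X Y : 𝓐} {P : ProjectiveResolution X} {Q : ExactAug Y}
    {f : X ⟶ Y} {φ ψ : P.complex ⟶ Q.complex} (hφ : IsOver P Q f φ) (hψ : IsOver P Q f ψ) :
    Nonempty (Homotopy φ ψ) := by
  obtain ⟨h⟩ := nonempty_homotopy_zero P Q (φ - ψ) (by
    rw [HomologicalComplex.sub_f_apply, Preadditive.sub_comp, hφ, hψ, sub_self])
  exact ⟨Homotopy.equivSubZero.symm h⟩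

end Lifting

section Ext

variable {A : Type u} [Category.{w} A] [Abelian A] [HasLimits A]

/-- The cochain complex `Hom_D(P_*, T)` in `A`, for a chain complex `P_*` in `Fun(D, Ab)`. -/
def homComplex {D : Type w} [SmallCategory D] (T : D ⥤ A)
    (P : ChainComplex (D ⥤ AddCommGrpCat.{w}) ℕ) : CochainComplex A ℕ where
  X n := (symHom T).obj (op (P.X n))
  d i j := (symHom T).map (P.d j i).op
  shape i j h := by
    rw [P.shape j i h, op_zero]
    exact (symHom T).map_zero _ _
  d_comp_d' i j k _ _ := by
    rw [← Functor.map_comp, ← op_comp, P.d_comp_d, op_zero]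
    exact (symHom T).map_zero _ _

/-- The groups `Ext^n_D(M, T)` with values in `A`: the derived functors of the symbolic hom functor
`Hom_D(-, T) : Fun(D, Ab)ᵒᵖ ⥤ A`, computed by a projective resolution of `M`. -/
def symExt {D : Type w} [SmallCategory D] (n : ℕ) (M : D ⥤ AddCommGrpCat.{w}) (T : D ⥤ A) : A :=
  (homComplex T (projectiveResolution M).complex).homology n

/-- The constant functor `ℤ : D ⥤ Ab`. -/
def constZ (D : Type w) [SmallCategory D] : D ⥤ AddCommGrpCat.{w} :=
  (Functor.const D).obj (AddCommGrpCat.of (ULift.{w} ℤ))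

section ChangeOfCategory

variable {D₁ : Type w} [SmallCategory D₁] {D₂ : Type w} [SmallCategory D₂]

/-- The morphism `Hom(M₁, T₁) ⟶ Hom(M₂, T₂)` induced by a functor `Φ : D₂ ⥤ D₁` and natural
transformations `τ : T₁ ∘ Φ ⟶ T₂` and `α : M₂ ⟶ M₁ ∘ Φ`. -/
def symMap (Φ : D₂ ⥤ D₁) {T₁ : D₁ ⥤ A} {T₂ : D₂ ⥤ A} (τ : Φ ⋙ T₁ ⟶ T₂)
    {M₁ : D₁ ⥤ AddCommGrpCat.{w}} {M₂ : D₂ ⥤ AddCommGrpCat.{w}} (α : M₂ ⟶ Φ ⋙ M₁) :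
    (symHom T₁).obj (op M₁) ⟶ (symHom T₂).obj (op M₂) :=
  symLift T₂ M₂ _
    { app := fun c => AddCommGrpCat.ofHom (AddMonoidHom.mk'
        (fun x => symEval T₁ M₁ (Φ.obj c) (α.app c x) ≫ τ.app c)
        (fun x y => by
          rw [← Preadditive.add_comp]
          refine congrArg (· ≫ τ.app c) ?_
          exact (congrArg (symEval T₁ M₁ (Φ.obj c)) (map_add (α.app c).hom x y)).trans
            (symEval_add T₁ M₁ (Φ.obj c) _ _)))
      naturality := fun c d s => by
        ext x
        have h : α.app d (M₂.map s x) = M₁.map (Φ.map s) (α.app c x) :=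
          ConcreteCategory.congr_hom (α.naturality s) x
        have h' : T₁.map (Φ.map s) ≫ τ.app d = τ.app c ≫ T₂.map s := τ.naturality s
        change symEval T₁ M₁ (Φ.obj d) (α.app d (M₂.map s x)) ≫ τ.app d =
          (symEval T₁ M₁ (Φ.obj c) (α.app c x) ≫ τ.app c) ≫ T₂.map s
        rw [h, symEval_map, Category.assoc, h', Category.assoc] }

theorem symMap_eval (Φ : D₂ ⥤ D₁) {T₁ : D₁ ⥤ A} {T₂ : D₂ ⥤ A} (τ : Φ ⋙ T₁ ⟶ T₂)
    {M₁ : D₁ ⥤ AddCommGrpCat.{w}} {M₂ : D₂ ⥤ AddCommGrpCat.{w}} (α : M₂ ⟶ Φ ⋙ M₁) (c : D₂)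
    (x : M₂.obj c) :
    symMap Φ τ α ≫ symEval T₂ M₂ c x = symEval T₁ M₁ (Φ.obj c) (α.app c x) ≫ τ.app c :=
  symLift_eval T₂ M₂ _ _ c x

/-- Restriction of a chain complex of functors along `Φ`. -/
def restrict (Φ : D₂ ⥤ D₁) (P : ChainComplex (D₁ ⥤ AddCommGrpCat.{w}) ℕ) :
    ChainComplex (D₂ ⥤ AddCommGrpCat.{w}) ℕ where
  X n := Φ ⋙ P.X n
  d i j := Functor.whiskerLeft Φ (P.d i j)
  shape i j h := by rw [P.shape i j h]; rfl
  d_comp_d' i j k _ _ := by rw [← Functor.whiskerLeft_comp, P.d_comp_d]; rfl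

/-- The cochain map `Hom(P₁, T₁) ⟶ Hom(P₂, T₂)` induced by `Φ`, `τ : T₁ ∘ Φ ⟶ T₂` and a chain map
`α : P₂ ⟶ P₁ ∘ Φ`. -/
def homComplexMap (Φ : D₂ ⥤ D₁) {T₁ : D₁ ⥤ A} {T₂ : D₂ ⥤ A} (τ : Φ ⋙ T₁ ⟶ T₂)
    {P₁ : ChainComplex (D₁ ⥤ AddCommGrpCat.{w}) ℕ} {P₂ : ChainComplex (D₂ ⥤ AddCommGrpCat.{w}) ℕ}
    (α : P₂ ⟶ restrict Φ P₁) : homComplex T₁ P₁ ⟶ homComplex T₂ P₂ where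
  f n := symMap Φ τ (α.f n)
  comm' i j _ := by
    refine symHom_ext T₂ _ fun c x => ?_
    have h : (α.f i).app c ((P₂.d j i).app c x) = (P₁.d j i).app (Φ.obj c) ((α.f j).app c x) :=
      (congrArg (fun γ : P₂.X j ⟶ Φ ⋙ P₁.X i => γ.app c x) (α.comm j i)).symm
    refine (Category.assoc _ _ _).trans ((congrArg (_ ≫ ·) (symHom_map_eval T₂ _ c x)).trans ?_)
    refine (symMap_eval Φ τ _ c _).trans ?_
    refine Eq.symm ((Category.assoc _ _ _).trans
      ((congrArg (_ ≫ ·) (symMap_eval Φ τ _ c x)).trans ?_))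
    refine (Category.assoc _ _ _).symm.trans (congrArg (· ≫ τ.app c) ?_)
    refine (symHom_map_eval T₁ (P₁.d j i) (Φ.obj c) _).trans ?_
    exact congrArg (symEval T₁ (P₁.X i) (Φ.obj c)) h.symm

theorem symMap_eq_comp (Φ : D₂ ⥤ D₁) {T₁ : D₁ ⥤ A} {T₂ : D₂ ⥤ A} (τ : Φ ⋙ T₁ ⟶ T₂)
    {M₁ : D₁ ⥤ AddCommGrpCat.{w}} {M₂ : D₂ ⥤ AddCommGrpCat.{w}} (α : M₂ ⟶ Φ ⋙ M₁) :
    symMap Φ τ α = symMap Φ τ (𝟙 (Φ ⋙ M₁)) ≫ (symHom T₂).map α.op := by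
  refine symHom_ext T₂ _ fun c x => ?_
  rw [symMap_eval, Category.assoc, symHom_map_eval, symMap_eval]
  rfl

theorem symMap_add (Φ : D₂ ⥤ D₁) {T₁ : D₁ ⥤ A} {T₂ : D₂ ⥤ A} (τ : Φ ⋙ T₁ ⟶ T₂)
    {M₁ : D₁ ⥤ AddCommGrpCat.{w}} {M₂ : D₂ ⥤ AddCommGrpCat.{w}} (α β : M₂ ⟶ Φ ⋙ M₁) :
    symMap Φ τ (α + β) = symMap Φ τ α + symMap Φ τ β := by
  rw [symMap_eq_comp, symMap_eq_comp Φ τ α, symMap_eq_comp Φ τ β, ← Preadditive.comp_add, op_add,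
    Functor.map_add]

theorem symMap_zero (Φ : D₂ ⥤ D₁) {T₁ : D₁ ⥤ A} {T₂ : D₂ ⥤ A} (τ : Φ ⋙ T₁ ⟶ T₂)
    (M₁ : D₁ ⥤ AddCommGrpCat.{w}) (M₂ : D₂ ⥤ AddCommGrpCat.{w}) :
    symMap Φ τ (0 : M₂ ⟶ Φ ⋙ M₁) = 0 := by
  rw [symMap_eq_comp, op_zero, Functor.map_zero, comp_zero]

theorem d_symMap (Φ : D₂ ⥤ D₁) {T₁ : D₁ ⥤ A} {T₂ : D₂ ⥤ A} (τ : Φ ⋙ T₁ ⟶ T₂)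
    {M₁ N₁ : D₁ ⥤ AddCommGrpCat.{w}} {M₂ : D₂ ⥤ AddCommGrpCat.{w}} (a : M₁ ⟶ N₁)
    (α : M₂ ⟶ Φ ⋙ M₁) :
    (symHom T₁).map a.op ≫ symMap Φ τ α = symMap Φ τ (α ≫ Functor.whiskerLeft Φ a) := by
  refine symHom_ext T₂ _ fun c x => ?_
  rw [Category.assoc, symMap_eval, ← Category.assoc, symHom_map_eval, symMap_eval]
  rfl

theorem symMap_d (Φ : D₂ ⥤ D₁) {T₁ : D₁ ⥤ A} {T₂ : D₂ ⥤ A} (τ : Φ ⋙ T₁ ⟶ T₂)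
    {M₁ : D₁ ⥤ AddCommGrpCat.{w}} {M₂ N₂ : D₂ ⥤ AddCommGrpCat.{w}} (a : M₂ ⟶ N₂)
    (α : N₂ ⟶ Φ ⋙ M₁) :
    symMap Φ τ α ≫ (symHom T₂).map a.op = symMap Φ τ (a ≫ α) := by
  refine symHom_ext T₂ _ fun c x => ?_
  rw [Category.assoc, symHom_map_eval, symMap_eval, symMap_eval]
  rfl

/-- Homotopic chain maps induce homotopic cochain maps. -/
def homComplexMapHomotopy (Φ : D₂ ⥤ D₁) {T₁ : D₁ ⥤ A} {T₂ : D₂ ⥤ A} (τ : Φ ⋙ T₁ ⟶ T₂)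
    {P₁ : ChainComplex (D₁ ⥤ AddCommGrpCat.{w}) ℕ} {P₂ : ChainComplex (D₂ ⥤ AddCommGrpCat.{w}) ℕ}
    {α β : P₂ ⟶ restrict Φ P₁} (h : Homotopy α β) :
    Homotopy (homComplexMap Φ τ α) (homComplexMap Φ τ β) where
  hom i j := symMap Φ τ (h.hom j i)
  zero i j hij := by
    rw [h.zero j i hij]
    exact symMap_zero Φ τ _ _
  comm i := by
    have hc := h.comm i
    rcases i with _ | i
    · rw [Homotopy.dNext_zero_chainComplex, zero_add, Homotopy.prevD_chainComplex] at hc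
      refine Eq.trans ?_ (congrArg (· + symMap Φ τ (β.f 0)) (congrArg₂ (· + ·)
        (Homotopy.dNext_cochainComplex _ _) (Homotopy.prevD_zero_cochainComplex _))).symm
      refine Eq.trans ?_ (congrArg (· + symMap Φ τ (β.f 0)) (add_zero _)).symm
      refine (congrArg (symMap Φ τ) hc).trans ((symMap_add Φ τ _ _).trans ?_)
      exact congrArg (· + symMap Φ τ (β.f 0)) (d_symMap Φ τ _ _).symm
    · rw [Homotopy.dNext_succ_chainComplex, Homotopy.prevD_chainComplex] at hc
      refine Eq.trans ?_ (congrArg (· + symMap Φ τ (β.f (i + 1))) (congrArg₂ (· + ·)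
        (Homotopy.dNext_cochainComplex _ _) (Homotopy.prevD_succ_cochainComplex _ _))).symm
      refine (congrArg (symMap Φ τ) hc).trans ((symMap_add Φ τ _ _).trans ?_)
      refine congrArg (· + symMap Φ τ (β.f (i + 1))) ((symMap_add Φ τ _ _).trans ?_)
      refine (add_comm _ _).trans ?_
      exact congrArg₂ (· + ·) (d_symMap Φ τ _ _).symm (symMap_d Φ τ _ _).symm

/-- The restriction of a projective resolution along `Φ` is exact. -/
def restrictRes (Φ : D₂ ⥤ D₁) {M : D₁ ⥤ AddCommGrpCat.{w}} (P : ProjectiveResolution M) :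
    ExactAug (Φ ⋙ M) where
  complex := restrict Φ P.complex
  aug := Functor.whiskerLeft Φ (resAug P)
  w := ((ShortComplex.mk (P.complex.d 1 0) (resAug P) P.complex_d_comp_π_f_zero).map
    ((Functor.whiskeringLeft D₂ D₁ AddCommGrpCat.{w}).obj Φ)).zero
  epi := by
    have : Epi (resAug P) := inferInstanceAs (Epi (P.π.f 0))
    exact inferInstanceAs (Epi (((Functor.whiskeringLeft D₂ D₁ AddCommGrpCat.{w}).obj Φ).map
      (resAug P)))
  exact₀ := P.exact₀.map ((Functor.whiskeringLeft D₂ D₁ AddCommGrpCat.{w}).obj Φ)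
  exact_succ n := (P.exact_succ n).map ((Functor.whiskeringLeft D₂ D₁ AddCommGrpCat.{w}).obj Φ)

/-- Chain maps `P₂ ⟶ P₁ ∘ Φ` of resolutions of the constant functors `ℤ` over the identity
of `ℤ`. -/
def IsComparison (Φ : D₂ ⥤ D₁) (P₁ : ProjectiveResolution (constZ D₁))
    (P₂ : ProjectiveResolution (constZ D₂)) (α : P₂.complex ⟶ restrict Φ P₁.complex) : Prop :=
  IsOver P₂ (restrictRes Φ P₁) (𝟙 (constZ D₂)) α

/-- A chosen comparison map between the chosen resolutions of `ℤ`. -/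
def comparison (Φ : D₂ ⥤ D₁) : (projectiveResolution (constZ D₂)).complex ⟶
    restrict Φ (projectiveResolution (constZ D₁)).complex :=
  (exists_isOver (projectiveResolution (constZ D₂))
    (restrictRes Φ (projectiveResolution (constZ D₁))) (𝟙 (constZ D₂))).choose

theorem isComparison_comparison (Φ : D₂ ⥤ D₁) :
    IsComparison Φ (projectiveResolution (constZ D₁)) (projectiveResolution (constZ D₂))
      (comparison Φ) :=
  (exists_isOver (projectiveResolution (constZ D₂))
    (restrictRes Φ (projectiveResolution (constZ D₁))) (𝟙 (constZ D₂))).choose_spec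

/-- All comparison maps induce the same map in cohomology. -/
theorem homologyMap_homComplexMap_eq (Φ : D₂ ⥤ D₁) {T₁ : D₁ ⥤ A} {T₂ : D₂ ⥤ A} (τ : Φ ⋙ T₁ ⟶ T₂)
    {P₁ : ProjectiveResolution (constZ D₁)} {P₂ : ProjectiveResolution (constZ D₂)}
    {α β : P₂.complex ⟶ restrict Φ P₁.complex} (hα : IsComparison Φ P₁ P₂ α)
    (hβ : IsComparison Φ P₁ P₂ β) (n : ℕ) :
    HomologicalComplex.homologyMap (homComplexMap Φ τ α) n =
      HomologicalComplex.homologyMap (homComplexMap Φ τ β) n := by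
  obtain ⟨h⟩ := IsOver.nonempty_homotopy hα hβ
  exact (homComplexMapHomotopy Φ τ h).homologyMap_eq n

/-- The morphism `Ext^n_{D₁}(ℤ, T₁) ⟶ Ext^n_{D₂}(ℤ, T₂)` induced by `Φ : D₂ ⥤ D₁` and
`τ : T₁ ∘ Φ ⟶ T₂`. -/
def extMap (n : ℕ) (Φ : D₂ ⥤ D₁) {T₁ : D₁ ⥤ A} {T₂ : D₂ ⥤ A} (τ : Φ ⋙ T₁ ⟶ T₂) :
    symExt n (constZ D₁) T₁ ⟶ symExt n (constZ D₂) T₂ :=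
  HomologicalComplex.homologyMap (homComplexMap Φ τ (comparison Φ)) n

end ChangeOfCategory

end Ext

section Comparison

variable {A : Type u} [Category.{w} A]

/-- The identity as a comparison map. -/
def idComparison (S : NatSystem A) (P : ChainComplex (SimplexCat S.base ⥤ AddCommGrpCat.{w}) ℕ) :
    P ⟶ restrict (SimplexCat.mapFunctor (NatSystem.Hom.functor (𝟙 S))) P where
  f n := { app := fun f => 𝟙 ((P.X n).obj f)
           naturality := fun f g x => (𝟙 (P.X n) : P.X n ⟶ P.X n).naturality x }
  comm' i j _ := by
    ext f : 2
    exact (Category.id_comp _).trans (Category.comp_id _).symm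

theorem isComparison_id (S : NatSystem A) (P : ProjectiveResolution (constZ (SimplexCat S.base))) :
    IsComparison (SimplexCat.mapFunctor (NatSystem.Hom.functor (𝟙 S))) P P
      (idComparison S P.complex) := by
  refine NatTrans.ext (funext fun c => ?_)
  exact (Category.id_comp _).trans (Category.comp_id _).symm

/-- The composition of comparison maps. -/
def compComparison {R S T : NatSystem A} (a : R ⟶ S) (b : S ⟶ T)
    {P : ChainComplex (SimplexCat R.base ⥤ AddCommGrpCat.{w}) ℕ}
    {Q : ChainComplex (SimplexCat S.base ⥤ AddCommGrpCat.{w}) ℕ}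
    {Q' : ChainComplex (SimplexCat T.base ⥤ AddCommGrpCat.{w}) ℕ}
    (α : Q ⟶ restrict (SimplexCat.mapFunctor a.functor) P)
    (β : Q' ⟶ restrict (SimplexCat.mapFunctor b.functor) Q) :
    Q' ⟶ restrict (SimplexCat.mapFunctor (a ≫ b).functor) P where
  f n :=
    { app := fun f => (β.f n).app f ≫ (α.f n).app ((SimplexCat.mapFunctor b.functor).obj f)
      naturality := fun f g x =>
        (β.f n ≫ Functor.whiskerLeft (SimplexCat.mapFunctor b.functor) (α.f n)).naturality x }
  comm' i j _ := by
    ext f : 2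
    have h₁ := congrArg (fun γ => NatTrans.app γ f) (β.comm i j)
    have h₂ := congrArg (fun γ => NatTrans.app γ ((SimplexCat.mapFunctor b.functor).obj f))
      (α.comm i j)
    refine (Category.assoc _ _ _).trans ((congrArg (_ ≫ ·) h₂).trans ?_)
    exact (Category.assoc _ _ _).symm.trans ((congrArg (· ≫ _) h₁).trans (Category.assoc _ _ _))

theorem isComparison_comp {R S T : NatSystem A} (a : R ⟶ S) (b : S ⟶ T)
    {P : ProjectiveResolution (constZ (SimplexCat R.base))}
    {Q : ProjectiveResolution (constZ (SimplexCat S.base))}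
    {Q' : ProjectiveResolution (constZ (SimplexCat T.base))}
    {α : Q.complex ⟶ restrict (SimplexCat.mapFunctor a.functor) P.complex}
    {β : Q'.complex ⟶ restrict (SimplexCat.mapFunctor b.functor) Q.complex}
    (hα : IsComparison _ P Q α) (hβ : IsComparison _ Q Q' β) :
    IsComparison (SimplexCat.mapFunctor (a ≫ b).functor) P Q' (compComparison a b α β) := by
  refine NatTrans.ext (funext fun f => ?_)
  have h₁ := congrArg (fun γ => NatTrans.app γ f) hβ
  have h₂ := congrArg (fun γ => NatTrans.app γ ((SimplexCat.mapFunctor b.functor).obj f)) hα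
  refine (Category.assoc _ _ _).trans ((congrArg (_ ≫ ·) (h₂.trans (Category.comp_id _))).trans ?_)
  exact h₁

end Comparison

section Ext

variable {A : Type u} [Category.{w} A] [Abelian A] [HasLimits A]

theorem homComplexMap_id (S : NatSystem A)
    (P : ChainComplex (SimplexCat S.base ⥤ AddCommGrpCat.{w}) ℕ) :
    homComplexMap (SimplexCat.mapFunctor (NatSystem.Hom.functor (𝟙 S)))
      (NatSystem.Hom.trans (𝟙 S)) (idComparison S P) = 𝟙 (homComplex S.system P) := by
  ext n
  refine symHom_ext S.system _ fun c x => (symMap_eval _ _ _ c x).trans ?_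
  exact (Category.comp_id _).trans (Category.id_comp _).symm

theorem homComplexMap_comp {R S T : NatSystem A} (a : R ⟶ S) (b : S ⟶ T)
    {P : ChainComplex (SimplexCat R.base ⥤ AddCommGrpCat.{w}) ℕ}
    {Q : ChainComplex (SimplexCat S.base ⥤ AddCommGrpCat.{w}) ℕ}
    {Q' : ChainComplex (SimplexCat T.base ⥤ AddCommGrpCat.{w}) ℕ}
    (α : Q ⟶ restrict (SimplexCat.mapFunctor a.functor) P)
    (β : Q' ⟶ restrict (SimplexCat.mapFunctor b.functor) Q) :
    homComplexMap (SimplexCat.mapFunctor (a ≫ b).functor) (a ≫ b).trans (compComparison a b α β) =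
      homComplexMap _ a.trans α ≫ homComplexMap _ b.trans β := by
  ext n
  refine symHom_ext T.system _ fun c x => (symMap_eval _ _ _ c x).trans ?_
  refine Eq.symm ((Category.assoc _ _ _).trans ((congrArg (_ ≫ ·) (symMap_eval _ _ _ c x)).trans ?_))
  refine (Category.assoc _ _ _).symm.trans ((congrArg (· ≫ _) (symMap_eval _ _ _ _ _)).trans ?_)
  exact Category.assoc _ _ _

/-- `Ext^n_{Δ/C}(ℤ, T)`, as a functor on the category of Thomason natural systems. -/
def extFunctor (A : Type u) [Category.{w} A] [Abelian A] [HasLimits A] (n : ℕ) :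
    NatSystem A ⥤ A where
  obj S := symExt n (constZ (SimplexCat S.base)) S.system
  map a := extMap n (SimplexCat.mapFunctor a.functor) a.trans
  map_id S := by
    refine (homologyMap_homComplexMap_eq _ _ (isComparison_comparison _)
      (isComparison_id S _) n).trans ?_
    rw [homComplexMap_id, HomologicalComplex.homologyMap_id]
    rfl
  map_comp a b := by
    refine (homologyMap_homComplexMap_eq _ _ (isComparison_comparison _)
      (isComparison_comp a b (isComparison_comparison _) (isComparison_comparison _)) n).trans ?_
    rw [homComplexMap_comp, HomologicalComplex.homologyMap_comp]
    rfl

end Ext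
/-! ### Cohomological δ-functors and derived functors -/

section DeltaFunctor

/-- A (cohomological, exact) δ-functor `F⁰, F¹, …` from `𝓐` to `𝓑`: additive functors together with
natural connecting morphisms such that every short exact sequence `0 ⟶ X₁ ⟶ X₂ ⟶ X₃ ⟶ 0` has an exact
sequence `0 ⟶ F⁰ X₁ ⟶ F⁰ X₂ ⟶ F⁰ X₃ ⟶ F¹ X₁ ⟶ F¹ X₂ ⟶ ⋯`. -/
structure DeltaFunctor (𝓐 : Type u₁) [Category.{v₁} 𝓐] [Abelian 𝓐] (𝓑 : Type u₂) [Category.{v₂} 𝓑]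
    [Abelian 𝓑] where
  F : ℕ → 𝓐 ⥤ 𝓑
  [additive : ∀ n, (F n).Additive]
  δ (n : ℕ) (S : ShortComplex 𝓐) (hS : S.ShortExact) : (F n).obj S.X₃ ⟶ (F (n + 1)).obj S.X₁
  δ_naturality (n : ℕ) {S S' : ShortComplex 𝓐} (hS : S.ShortExact) (hS' : S'.ShortExact)
    (φ : S ⟶ S') : (F n).map φ.τ₃ ≫ δ n S' hS' = δ n S hS ≫ (F (n + 1)).map φ.τ₁
  map_comp_δ (n : ℕ) (S : ShortComplex 𝓐) (hS : S.ShortExact) : (F n).map S.g ≫ δ n S hS = 0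
  δ_comp_map (n : ℕ) (S : ShortComplex 𝓐) (hS : S.ShortExact) : δ n S hS ≫ (F (n + 1)).map S.f = 0
  mono (S : ShortComplex 𝓐) (hS : S.ShortExact) : Mono ((F 0).map S.f)
  exact₂ (n : ℕ) (S : ShortComplex 𝓐) (hS : S.ShortExact) : (S.map (F n)).Exact
  exact₃ (n : ℕ) (S : ShortComplex 𝓐) (hS : S.ShortExact) :
    (ShortComplex.mk _ _ (map_comp_δ n S hS)).Exact
  exact₁ (n : ℕ) (S : ShortComplex 𝓐) (hS : S.ShortExact) :
    (ShortComplex.mk _ _ (δ_comp_map n S hS)).Exact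

attribute [instance] DeltaFunctor.additive

variable {𝓐 : Type u₁} [Category.{v₁} 𝓐] [Abelian 𝓐] {𝓑 : Type u₂} [Category.{v₂} 𝓑] [Abelian 𝓑]

/-- A morphism of δ-functors: natural transformations `Fⁿ ⟶ Gⁿ` compatible with the connecting
morphisms. -/
@[ext]
structure DeltaFunctor.Hom (F G : DeltaFunctor 𝓐 𝓑) where
  app (n : ℕ) : F.F n ⟶ G.F n
  comm (n : ℕ) (S : ShortComplex 𝓐) (hS : S.ShortExact) :
    F.δ n S hS ≫ (app (n + 1)).app S.X₁ = (app n).app S.X₃ ≫ G.δ n S hS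

/-- A δ-functor is universal if every natural transformation `F⁰ ⟶ G⁰` to the degree `0` part of a
δ-functor `G` extends uniquely to a morphism of δ-functors. -/
def DeltaFunctor.IsUniversal (F : DeltaFunctor 𝓐 𝓑) : Prop :=
  ∀ (G : DeltaFunctor 𝓐 𝓑) (f : F.F 0 ⟶ G.F 0), ∃! φ : DeltaFunctor.Hom F G, φ.app 0 = f

/-- The right derived functors (right satellites) of a functor `L : 𝓐 ⥤ 𝓑`: a universal δ-functor
together with an isomorphism of its degree `0` part with `L`. They are unique up to unique
isomorphism. This notion needs no injective objects. -/
structure RightDerived (L : 𝓐 ⥤ 𝓑) where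
  delta : DeltaFunctor 𝓐 𝓑
  universal : delta.IsUniversal
  iso : delta.F 0 ≅ L

/-- Restriction of a δ-functor along an exact functor. -/
def DeltaFunctor.precomp {𝓒 : Type u₃} [Category.{v₃} 𝓒] [Abelian 𝓒] (E : 𝓒 ⥤ 𝓐) [E.Additive]
    [PreservesFiniteLimits E] [PreservesFiniteColimits E] (F : DeltaFunctor 𝓐 𝓑) :
    DeltaFunctor 𝓒 𝓑 where
  F n := E ⋙ F.F n
  δ n S hS := F.δ n (S.map E) (hS.map_of_exact E)
  δ_naturality n _ _ hS hS' φ := F.δ_naturality n (hS.map_of_exact E) (hS'.map_of_exact E)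
    (E.mapShortComplex.map φ)
  map_comp_δ n S hS := F.map_comp_δ n (S.map E) (hS.map_of_exact E)
  δ_comp_map n S hS := F.δ_comp_map n (S.map E) (hS.map_of_exact E)
  mono S hS := F.mono (S.map E) (hS.map_of_exact E)
  exact₂ n S hS := F.exact₂ n (S.map E) (hS.map_of_exact E)
  exact₃ n S hS := F.exact₃ n (S.map E) (hS.map_of_exact E)
  exact₁ n S hS := F.exact₁ n (S.map E) (hS.map_of_exact E)

/-- The unique morphism of δ-functors extending a given natural transformation in degree `0`. -/
def DeltaFunctor.IsUniversal.lift {F : DeltaFunctor 𝓐 𝓑} (h : F.IsUniversal)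
    (G : DeltaFunctor 𝓐 𝓑) (f : F.F 0 ⟶ G.F 0) : DeltaFunctor.Hom F G := (h G f).choose

theorem DeltaFunctor.IsUniversal.lift_zero {F : DeltaFunctor 𝓐 𝓑} (h : F.IsUniversal)
    (G : DeltaFunctor 𝓐 𝓑) (f : F.F 0 ⟶ G.F 0) : (h.lift G f).app 0 = f := (h G f).choose_spec.1

theorem DeltaFunctor.IsUniversal.hom_ext {F : DeltaFunctor 𝓐 𝓑} (h : F.IsUniversal)
    {G : DeltaFunctor 𝓐 𝓑} {φ ψ : DeltaFunctor.Hom F G} (h₀ : φ.app 0 = ψ.app 0) : φ = ψ :=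
  (h G (ψ.app 0)).unique h₀ rfl

end DeltaFunctor

section DerivedLimit

variable {A : Type u} [Category.{w} A] [Abelian A] [HasLimits A]

section

variable {D₁ : Type w} [SmallCategory D₁] {D₂ : Type w} [SmallCategory D₂]

/-- The natural morphism `lim_{D₁} T ⟶ lim_{D₂} (T ∘ Φ)`. -/
def limPre (A : Type u) [Category.{w} A] [HasLimits A] (Φ : D₂ ⥤ D₁) :
    (lim : (D₁ ⥤ A) ⥤ A) ⟶ (Functor.whiskeringLeft D₂ D₁ A).obj Φ ⋙ lim where
  app T := limit.pre T Φ
  naturality T T' τ := by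
    refine limit.hom_ext fun d => ?_
    simp

/-- The morphism of δ-functors `lim^n_{D₁} T ⟶ lim^n_{D₂} (T ∘ Φ)` which extends the natural morphism
of limits. -/
def limRestrict (Φ : D₂ ⥤ D₁) (L₁ : RightDerived (lim : (D₁ ⥤ A) ⥤ A))
    (L₂ : RightDerived (lim : (D₂ ⥤ A) ⥤ A)) :
    DeltaFunctor.Hom L₁.delta (L₂.delta.precomp ((Functor.whiskeringLeft D₂ D₁ A).obj Φ)) :=
  L₁.universal.lift _ (L₁.iso.hom ≫ limPre A Φ ≫
    Functor.whiskerLeft ((Functor.whiskeringLeft D₂ D₁ A).obj Φ) L₂.iso.inv)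

theorem limRestrict_zero (Φ : D₂ ⥤ D₁) (L₁ : RightDerived (lim : (D₁ ⥤ A) ⥤ A))
    (L₂ : RightDerived (lim : (D₂ ⥤ A) ⥤ A)) (T : D₁ ⥤ A) :
    ((limRestrict Φ L₁ L₂).app 0).app T =
      L₁.iso.hom.app T ≫ limit.pre T Φ ≫ L₂.iso.inv.app (Φ ⋙ T) :=
  congrArg (fun γ => NatTrans.app γ T) (L₁.universal.lift_zero _ _)

end

/-- A choice of derived limits `lim^n_{Δ/C}`, for all small categories `C`. -/
abbrev DerivedLimits (A : Type u) [Category.{w} A] [Abelian A] [HasLimits A] :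
    Type (max u (w + 1)) :=
  ∀ (C : Type w) [SmallCategory C], RightDerived (lim : (SimplexCat C ⥤ A) ⥤ A)

/-- The identity as a morphism of δ-functors. -/
def limRestrictId (S : NatSystem A) (L : RightDerived (lim : (SimplexCat S.base ⥤ A) ⥤ A)) :
    DeltaFunctor.Hom L.delta (L.delta.precomp ((Functor.whiskeringLeft _ _ A).obj
      (SimplexCat.mapFunctor (NatSystem.Hom.functor (𝟙 S))))) where
  app n :=
    { app := fun T => 𝟙 ((L.delta.F n).obj T)
      naturality := fun _ _ τ => (𝟙 (L.delta.F n) : L.delta.F n ⟶ L.delta.F n).naturality τ }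
  comm _ _ _ := (Category.comp_id _).trans (Category.id_comp _).symm

/-- The composition of two restriction morphisms. -/
def limRestrictComp (L : DerivedLimits A) {R S T : NatSystem A} (a : R ⟶ S) (b : S ⟶ T) :
    DeltaFunctor.Hom (L R.base).delta ((L T.base).delta.precomp ((Functor.whiskeringLeft _ _ A).obj
      (SimplexCat.mapFunctor (a ≫ b).functor))) where
  app n :=
    { app := fun X =>
        ((limRestrict (SimplexCat.mapFunctor a.functor) (L R.base) (L S.base)).app n).app X ≫
        ((limRestrict (SimplexCat.mapFunctor b.functor) (L S.base) (L T.base)).app n).app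
          (SimplexCat.mapFunctor a.functor ⋙ X)
      naturality := fun X X' τ =>
        ((limRestrict (SimplexCat.mapFunctor a.functor) (L R.base) (L S.base)).app n ≫
        Functor.whiskerLeft ((Functor.whiskeringLeft _ _ A).obj (SimplexCat.mapFunctor a.functor))
          ((limRestrict (SimplexCat.mapFunctor b.functor) (L S.base)
            (L T.base)).app n)).naturality τ }
  comm n Q hQ := by
    have h₁ := (limRestrict (SimplexCat.mapFunctor a.functor) (L R.base) (L S.base)).comm n Q hQ
    have h₂ := (limRestrict (SimplexCat.mapFunctor b.functor) (L S.base) (L T.base)).comm n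
      (Q.map ((Functor.whiskeringLeft _ _ A).obj (SimplexCat.mapFunctor a.functor)))
      (hQ.map_of_exact _)
    refine (Category.assoc _ _ _).symm.trans ((congrArg (· ≫ _) h₁).trans ?_)
    exact (Category.assoc _ _ _).trans ((congrArg (_ ≫ ·) h₂).trans (Category.assoc _ _ _).symm)

theorem limRestrict_id (S : NatSystem A) (L : RightDerived (lim : (SimplexCat S.base ⥤ A) ⥤ A)) :
    limRestrict (SimplexCat.mapFunctor (NatSystem.Hom.functor (𝟙 S))) L L = limRestrictId S L := by
  refine L.universal.hom_ext (NatTrans.ext (funext fun T => ?_))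
  refine (limRestrict_zero _ L L T).trans ?_
  have h : limit.pre T (SimplexCat.mapFunctor (NatSystem.Hom.functor (𝟙 S))) = 𝟙 (limit T) :=
    limit.hom_ext fun d => (limit.pre_π _ _ _).trans (Category.id_comp _).symm
  refine (congrArg (fun γ => L.iso.hom.app T ≫ γ ≫ L.iso.inv.app T) h).trans ?_
  exact (congrArg (_ ≫ ·) (Category.id_comp _)).trans (L.iso.hom_inv_id_app T)

theorem limRestrict_comp (L : DerivedLimits A) {R S T : NatSystem A} (a : R ⟶ S) (b : S ⟶ T) :
    limRestrict (SimplexCat.mapFunctor (a ≫ b).functor) (L R.base) (L T.base) =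
      limRestrictComp L a b := by
  refine (L R.base).universal.hom_ext (NatTrans.ext (funext fun X => ?_))
  refine (limRestrict_zero _ _ _ X).trans ?_
  refine Eq.symm ((congrArg₂ (· ≫ ·) (limRestrict_zero _ _ _ X) (limRestrict_zero _ _ _ _)).trans ?_)
  have h : limit.pre X (SimplexCat.mapFunctor a.functor) ≫
      limit.pre (SimplexCat.mapFunctor a.functor ⋙ X) (SimplexCat.mapFunctor b.functor) =
      limit.pre X (SimplexCat.mapFunctor (a ≫ b).functor) :=
    limit.hom_ext fun d => by
      refine (Category.assoc _ _ _).trans ((congrArg (_ ≫ ·) (limit.pre_π _ _ _)).trans ?_)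
      exact (limit.pre_π _ _ _).trans
        (limit.pre_π X (SimplexCat.mapFunctor (a ≫ b).functor) d).symm
  refine (Category.assoc _ _ _).trans (congrArg (_ ≫ ·) ?_)
  refine (Category.assoc _ _ _).trans ?_
  refine (congrArg (_ ≫ ·) ((L S.base).iso.inv_hom_id_app_assoc _ _)).trans ?_
  exact (Category.assoc _ _ _).symm.trans (congrArg (· ≫ _) h)

/-- The derived limit `lim^n_{Δ/C} T`, as a functor on the category of Thomason natural systems. A
morphism `(φ, τ)` induces the composite `lim^n T₁ ⟶ lim^n (T₁ ∘ Δ/φ) ⟶ lim^n T₂`. -/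
def DerivedLimits.functor (L : DerivedLimits A) (n : ℕ) : NatSystem A ⥤ A where
  obj S := ((L S.base).delta.F n).obj S.system
  map {S T} a :=
    ((limRestrict (SimplexCat.mapFunctor a.functor) (L S.base) (L T.base)).app n).app S.system ≫
      ((L T.base).delta.F n).map a.trans
  map_id S := by
    have h := congrArg (fun γ => (DeltaFunctor.Hom.app γ n).app S.system) (limRestrict_id S (L S.base))
    refine (congrArg (· ≫ _) h).trans ?_
    refine (Category.id_comp _).trans ?_
    exact ((L S.base).delta.F n).map_id S.system
  map_comp {R S T} a b := by
    have h := congrArg (fun γ => (DeltaFunctor.Hom.app γ n).app R.system) (limRestrict_comp L a b)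
    refine (congrArg (· ≫ _) h).trans ?_
    have h₁ := ((limRestrict (SimplexCat.mapFunctor b.functor) (L S.base)
      (L T.base)).app n).naturality a.trans
    have h₂ : ((L T.base).delta.F n).map (a ≫ b).trans = ((L T.base).delta.F n).map
        (Functor.whiskerLeft (SimplexCat.mapFunctor b.functor) a.trans) ≫
        ((L T.base).delta.F n).map b.trans :=
      ((L T.base).delta.F n).map_comp
        (Functor.whiskerLeft (SimplexCat.mapFunctor b.functor) a.trans) b.trans
    refine (congrArg (_ ≫ ·) h₂).trans ?_
    refine (Category.assoc _ _ _).trans (Eq.trans ?_ (Category.assoc _ _ _).symm)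
    refine congrArg (_ ≫ ·) ?_
    refine (Category.assoc _ _ _).symm.trans (Eq.trans ?_ (Category.assoc _ _ _))
    exact congrArg (· ≫ _) h₁.symm

end DerivedLimit

end Thomason

end

/-! Both isomorphisms rest on one combinatorial fact. The map `shift`, which prepends the vertex 0
to a simplex of `Δ[m]`, contracts the augmented (co)chains of a standard simplex. Moreover a
morphism of `Δ/C` from an `n`-simplex to `g` is the same thing as a map `σ : [n] ⟶ g.dim`, its
source being forced to be `g ∘ σ`.

Derived limits: since products are exact, the Thomason complex is an exact functor of `T`, so its
cohomology is a δ-functor (`thomasonDelta`). In degree 0 a cocycle assigns the same value to both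
ends of every edge; as any two vertices of a simplex span an edge, the cocycles are the compatible
families, that is, the limit (`limitIsoCohomology`). Every `T` embeds functorially in the coinduced
system `c ↦ ∏_{c ⟶ d} T d`. The cochains of that system split as a product over `g` of the cochains
of `Δ[dim g]` with coefficients `T g`, so they are acyclic in positive degrees
(`isZero_homology_coind`). By Grothendieck's effaceability criterion
(`DeltaFunctor.Effacement.isUniversal`) the δ-functor is universal. No injective objects are needed.
Compatibility with change of category is again a consequence of universality: it is enough to
compare in degree 0 (`comparison_restrict`).

Ext: the functors `g ↦ ℤ Δ([n], dim g)` are free on the identity generators of the `n`-simplices of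
`C`, hence projective. At each `g` they form the chains of a standard simplex, so they resolve the
constant functor `ℤ` (`barResolution`). By freeness, the symbolic hom out of this resolution is the
Thomason complex (`barHomComplexIso`). Independence of the resolution and the naturality of the bar
resolution then give `extIsoThomason`. -/

noncomputable section

namespace Thomason

/-! ### Effaceable δ-functors are universal. -/

section Universality

variable {𝓐 : Type u₁} [Category.{v₁} 𝓐] [Abelian 𝓐] {𝓑 : Type u₂} [Category.{v₂} 𝓑] [Abelian 𝓑]

/-- A functorial embedding of the objects of `𝓐` into objects on which the positive degrees of a
δ-functor vanish. -/
structure DeltaFunctor.Effacement (F : DeltaFunctor 𝓐 𝓑) where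
  J : 𝓐 ⥤ 𝓐
  η : 𝟭 𝓐 ⟶ J
  mono (X : 𝓐) : Mono (η.app X)
  isZero (n : ℕ) (X : 𝓐) : IsZero ((F.F (n + 1)).obj (J.obj X))

namespace DeltaFunctor

/-- The short complex `X ⟶ Y ⟶ coker` of a morphism. -/
abbrev cokerComplex {X Y : 𝓐} (i : X ⟶ Y) : ShortComplex 𝓐 :=
  ShortComplex.mk i (cokernel.π i) (cokernel.condition i)

theorem cokerComplex_shortExact {X Y : 𝓐} (i : X ⟶ Y) [Mono i] :
    (cokerComplex i).ShortExact :=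
  ShortComplex.ShortExact.mk' (ShortComplex.exact_cokernel i) inferInstance inferInstance

/-- The morphism of cokernel short complexes given by a commutative square. -/
abbrev cokerComplexMap {X Y X' Y' : 𝓐} (i : X ⟶ Y) (i' : X' ⟶ Y') (f : X ⟶ X') (g : Y ⟶ Y')
    (h : i ≫ g = f ≫ i') : cokerComplex i ⟶ cokerComplex i' where
  τ₁ := f
  τ₂ := g
  τ₃ := cokernel.map i i' f g h
  comm₁₂ := h.symm
  comm₂₃ := by simp

variable (F G : DeltaFunctor 𝓐 𝓑)

/-- Exactness at `Fⁿ⁺¹ X₁`: the map that follows `δ` has zero target. Hence `Fⁿ⁺¹ X₁` is the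
cokernel of `Fⁿ X₂ ⟶ Fⁿ X₃`, and morphisms out of it are determined, and can be constructed, in
degree `n`. -/
theorem epi_δ (n : ℕ) (S : ShortComplex 𝓐) (hS : S.ShortExact)
    (h : IsZero ((F.F (n + 1)).obj S.X₂)) : Epi (F.δ n S hS) :=
  (F.exact₁ n S hS).epi_f (h.eq_of_tgt _ _)

variable {F G}

/-- The morphism in degree `n + 1` induced by a morphism in degree `n`, for a short exact sequence
with effaced middle term. -/
def stepApp {n : ℕ} (φ : F.F n ⟶ G.F n) (S : ShortComplex 𝓐) (hS : S.ShortExact)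
    (h : IsZero ((F.F (n + 1)).obj S.X₂)) : (F.F (n + 1)).obj S.X₁ ⟶ (G.F (n + 1)).obj S.X₁ :=
  haveI := F.epi_δ n S hS h
  (F.exact₃ n S hS).desc (φ.app S.X₃ ≫ G.δ n S hS) (by
    dsimp only
    rw [← Category.assoc, φ.naturality, Category.assoc, G.map_comp_δ, comp_zero])

theorem δ_stepApp {n : ℕ} (φ : F.F n ⟶ G.F n) (S : ShortComplex 𝓐) (hS : S.ShortExact)
    (h : IsZero ((F.F (n + 1)).obj S.X₂)) :
    F.δ n S hS ≫ stepApp φ S hS h = φ.app S.X₃ ≫ G.δ n S hS :=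
  have := F.epi_δ n S hS h
  (F.exact₃ n S hS).g_desc _ _

theorem δ_stepApp_assoc {n : ℕ} (φ : F.F n ⟶ G.F n) (S : ShortComplex 𝓐) (hS : S.ShortExact)
    (h : IsZero ((F.F (n + 1)).obj S.X₂)) {Y : 𝓑} (y : (G.F (n + 1)).obj S.X₁ ⟶ Y) :
    F.δ n S hS ≫ stepApp φ S hS h ≫ y = φ.app S.X₃ ≫ G.δ n S hS ≫ y := by
  rw [← Category.assoc, δ_stepApp, Category.assoc]

/-- After cancelling the epimorphism `δ`, only the naturality of `φ` and of the two connecting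
morphisms remains. Applied to morphisms with `τ₁ = 𝟙`, it also shows that the induced map does not
depend on the effacing sequence. -/
theorem stepApp_naturality {n : ℕ} (φ : F.F n ⟶ G.F n) {S S' : ShortComplex 𝓐}
    (hS : S.ShortExact) (hS' : S'.ShortExact) (h : IsZero ((F.F (n + 1)).obj S.X₂))
    (h' : IsZero ((F.F (n + 1)).obj S'.X₂)) (a : S ⟶ S') :
    (F.F (n + 1)).map a.τ₁ ≫ stepApp φ S' hS' h' = stepApp φ S hS h ≫ (G.F (n + 1)).map a.τ₁ := by
  have := F.epi_δ n S hS h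
  rw [← cancel_epi (F.δ n S hS), ← Category.assoc, ← F.δ_naturality n hS hS' a, Category.assoc,
    δ_stepApp, δ_stepApp_assoc, ← G.δ_naturality n hS hS' a, ← Category.assoc, φ.naturality,
    Category.assoc]

namespace Effacement

instance (E : F.Effacement) (X : 𝓐) : Mono (E.η.app X) := E.mono X

/-- Dimension shifting. The map at `X` is forced by the sequence `X ⟶ J X ⟶ coker`; what needs proof
is compatibility with the connecting morphisms of an arbitrary short exact sequence. -/
theorem existsUnique_step (E : F.Effacement) {n : ℕ} (φ : F.F n ⟶ G.F n) :
    ∃! ψ : F.F (n + 1) ⟶ G.F (n + 1), ∀ (S : ShortComplex 𝓐) (hS : S.ShortExact),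
      F.δ n S hS ≫ ψ.app S.X₁ = φ.app S.X₃ ≫ G.δ n S hS := by
  refine ⟨⟨fun X => stepApp φ (cokerComplex (E.η.app X)) (cokerComplex_shortExact _)
    (E.isZero n X), fun X Y f => ?_⟩, fun S hS => ?_, fun ψ hψ => ?_⟩
  · exact stepApp_naturality φ _ _ _ _
      (cokerComplexMap (E.η.app X) (E.η.app Y) f (E.J.map f) (E.η.naturality f).symm)
  · have := hS.mono_f
    have := hS.epi_g
    -- The cokernel sequence of `X₁ ⟶ X₂ ⟶ J X₂` receives morphisms that are the identity on `X₁`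
    -- both from `S` and from the effacing sequence of `X₁`. The second one identifies the induced
    -- maps (`h₂`); the first one (`c`) factors the connecting morphisms of `S` through those of
    -- this sequence.
    let i : S.X₁ ⟶ E.J.obj S.X₂ := S.f ≫ E.η.app S.X₂
    have hi := cokerComplex_shortExact i
    have h₁ := stepApp_naturality φ (cokerComplex_shortExact (E.η.app S.X₁)) hi (E.isZero n _)
      (E.isZero n S.X₂) (cokerComplexMap (E.η.app S.X₁) i (𝟙 _) (E.J.map S.f)
        ((E.η.naturality S.f).symm.trans (Category.id_comp _).symm))
    have h₂ : stepApp φ (cokerComplex i) hi (E.isZero n S.X₂) =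
        stepApp φ (cokerComplex (E.η.app S.X₁)) (cokerComplex_shortExact _) (E.isZero n _) := by
      simpa using h₁
    let c : S ⟶ cokerComplex i :=
      { τ₁ := 𝟙 _
        τ₂ := E.η.app S.X₂
        τ₃ := hS.exact.desc (E.η.app S.X₂ ≫ cokernel.π i) (by
          rw [← Category.assoc]
          exact cokernel.condition i)
        comm₁₂ := Category.id_comp _
        comm₂₃ := (hS.exact.g_desc _ _).symm }
    have h₃ := F.δ_naturality n hS hi c
    have h₄ := G.δ_naturality n hS hi c
    have e₁ : (F.F (n + 1)).map c.τ₁ = 𝟙 _ := (F.F (n + 1)).map_id _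
    have e₂ : (G.F (n + 1)).map c.τ₁ = 𝟙 _ := (G.F (n + 1)).map_id _
    rw [e₁] at h₃
    rw [e₂] at h₄
    have h₅ : F.δ n S hS = (F.F n).map c.τ₃ ≫ F.δ n (cokerComplex i) hi :=
      (h₃.trans (Category.comp_id _)).symm
    have h₆ : G.δ n S hS = (G.F n).map c.τ₃ ≫ G.δ n (cokerComplex i) hi :=
      (h₄.trans (Category.comp_id _)).symm
    have h₇ := δ_stepApp φ (cokerComplex i) hi (E.isZero n S.X₂)
    rw [h₂] at h₇
    rw [h₅, h₆]
    refine (Category.assoc _ _ _).trans ((congrArg (_ ≫ ·) h₇).trans ?_)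
    rw [← Category.assoc, φ.naturality, Category.assoc]
  -- Uniqueness: the condition on the sequence `X ⟶ J X ⟶ coker` alone determines `ψ` at `X`,
  -- because `δ` is epi there.
  · ext X
    have := F.epi_δ n (cokerComplex (E.η.app X)) (cokerComplex_shortExact _) (E.isZero n X)
    rw [← cancel_epi (F.δ n (cokerComplex (E.η.app X)) (cokerComplex_shortExact _))]
    exact (hψ _ _).trans (δ_stepApp φ _ _ (E.isZero n X)).symm

/-- A δ-functor whose positive degrees are effaceable is universal. -/
theorem isUniversal (E : F.Effacement) : F.IsUniversal := fun G f => by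
  let φ : ∀ n, F.F n ⟶ G.F n := fun n =>
    Nat.rec (motive := fun n => F.F n ⟶ G.F n) f (fun _ ψ => (E.existsUnique_step ψ).choose) n
  refine ⟨⟨φ, fun n => (E.existsUnique_step (φ n)).choose_spec.1⟩, rfl, fun ψ hψ => ?_⟩
  refine DeltaFunctor.Hom.ext (funext fun n => ?_)
  induction n with
  | zero => exact hψ
  | succ n ih =>
    refine (E.existsUnique_step (φ n)).unique (fun S hS => ?_)
      (E.existsUnique_step (φ n)).choose_spec.1
    rw [ψ.comm n S hS, ih]

end Effacement

end DeltaFunctor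

end Universality

/-! ### Morphisms of natural systems as restrictions followed by morphisms over a fixed category. -/

section Restriction

variable {A : Type u} [Category.{w} A]

/-- The natural systems on a fixed category. -/
def natSystemOf (A : Type u) [Category.{w} A] (C : Type w) [SmallCategory C] :
    (SimplexCat C ⥤ A) ⥤ NatSystem A where
  obj T := ⟨C, T⟩
  map {T T'} τ := NatSystem.Hom.mk (𝟭 C)
    { app := fun f => τ.app f
      naturality := fun _ _ s => τ.naturality s }

/-- The restriction of a natural system along a functor. -/
def restrictHom {C₁ : Type w} [SmallCategory C₁] {C₂ : Type w} [SmallCategory C₂] (φ : C₂ ⥤ C₁)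
    (T : SimplexCat C₁ ⥤ A) :
    (natSystemOf A C₁).obj T ⟶ (natSystemOf A C₂).obj (SimplexCat.mapFunctor φ ⋙ T) :=
  NatSystem.Hom.mk φ (𝟙 _)

theorem natSystemOf_map_restrictHom {C₁ : Type w} [SmallCategory C₁] {C₂ : Type w}
    [SmallCategory C₂] (φ : C₂ ⥤ C₁) {T T' : SimplexCat C₁ ⥤ A} (τ : T ⟶ T') :
    (natSystemOf A C₁).map τ ≫ restrictHom φ T' =
      restrictHom φ T ≫ (natSystemOf A C₂).map
        (Functor.whiskerLeft (SimplexCat.mapFunctor φ) τ) := by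
  refine congrArg (NatSystem.Hom.mk (S := (natSystemOf A C₁).obj T)
    (T := (natSystemOf A C₂).obj (SimplexCat.mapFunctor φ ⋙ T')) φ)
    (NatTrans.ext (funext fun f => ?_))
  exact (Category.comp_id _).trans (Category.id_comp _).symm

/-- Reduces naturality in `(C, T)` to two separate cases: restriction along a functor, and a natural
transformation over a fixed category. -/
theorem restrictHom_comp {S T : NatSystem A} (a : S ⟶ T) :
    restrictHom a.functor S.system ≫ (natSystemOf A T.base).map a.trans = a := by
  refine congrArg (NatSystem.Hom.mk a.functor) (NatTrans.ext (funext fun f => ?_))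
  exact Category.id_comp _

end Restriction

/-! ### Thomason cohomology as a δ-functor. -/

section ThomasonComplex

variable {A : Type u} [Category.{w} A] [Abelian A] [HasProducts.{w} A]

/-- The projection of the Thomason cochains onto the factor of a simplex. -/
def cochainπ (S : NatSystem A) {n : ℕ} (f : Fin (n + 1) ⥤ S.base) :
    ((thomasonComplex A).obj S).X n ⟶ S.system.obj ⟨SimplexCategory.mk n, f⟩ :=
  Pi.π (fun f : Fin (n + 1) ⥤ S.base => S.system.obj ⟨SimplexCategory.mk n, f⟩) f

/-- The morphism into the Thomason cochains with given components. -/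
def cochainLift (S : NatSystem A) {n : ℕ} {X : A}
    (x : ∀ f : Fin (n + 1) ⥤ S.base, X ⟶ S.system.obj ⟨SimplexCategory.mk n, f⟩) :
    X ⟶ ((thomasonComplex A).obj S).X n :=
  Pi.lift x

@[simp]
theorem cochainLift_π (S : NatSystem A) {n : ℕ} {X : A}
    (x : ∀ f : Fin (n + 1) ⥤ S.base, X ⟶ S.system.obj ⟨SimplexCategory.mk n, f⟩)
    (f : Fin (n + 1) ⥤ S.base) : cochainLift S x ≫ cochainπ S f = x f :=
  Pi.lift_π _ _

@[simp]
theorem cochainLift_π_assoc (S : NatSystem A) {n : ℕ} {X : A}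
    (x : ∀ f : Fin (n + 1) ⥤ S.base, X ⟶ S.system.obj ⟨SimplexCategory.mk n, f⟩)
    (f : Fin (n + 1) ⥤ S.base) {Y : A}
    (y : S.system.obj ⟨SimplexCategory.mk n, f⟩ ⟶ Y) :
    cochainLift S x ≫ cochainπ S f ≫ y = x f ≫ y := by
  rw [← Category.assoc, cochainLift_π]

theorem cochain_ext (S : NatSystem A) {n : ℕ} {X : A}
    {x y : X ⟶ ((thomasonComplex A).obj S).X n}
    (h : ∀ f : Fin (n + 1) ⥤ S.base, x ≫ cochainπ S f = y ≫ cochainπ S f) : x = y :=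
  Pi.hom_ext _ _ h

theorem thomasonComplex_map_f_π {S T : NatSystem A} (a : S ⟶ T) {n : ℕ}
    (g : Fin (n + 1) ⥤ T.base) :
    ((thomasonComplex A).map a).f n ≫ cochainπ T g = cochainπ S (g ⋙ a.functor) ≫ a.at g :=
  Pi.lift_π _ _

theorem thomasonComplex_d_π (S : NatSystem A) {n : ℕ} (g : Fin (n + 1 + 1) ⥤ S.base) :
    ((thomasonComplex A).obj S).d n (n + 1) ≫ cochainπ S g =
      ∑ i : Fin (n + 2), (-1 : ℤ) ^ (i : ℕ) •
        (cochainπ S (toFunctor (SimplexCategory.δ i) ⋙ g) ≫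
          S.system.map (SimplexCat.pull (SimplexCategory.δ i) g)) := by
  refine (congrArg (· ≫ cochainπ S g) (thomasonComplex_d A S n)).trans
    ((Preadditive.sum_comp _ _ _).trans (Finset.sum_congr rfl fun i _ => ?_))
  exact (Preadditive.zsmul_comp _ _ _).trans (congrArg _ (Pi.lift_π _ _))

variable (A) in
/-- The Thomason complex on a fixed category. -/
def systemComplex (C : Type w) [SmallCategory C] :
    (SimplexCat C ⥤ A) ⥤ CochainComplex A ℕ :=
  natSystemOf A C ⋙ thomasonComplex A

variable {C : Type w} [SmallCategory C]

theorem systemComplex_map_f_π {T T' : SimplexCat C ⥤ A} (τ : T ⟶ T') {n : ℕ}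
    (f : Fin (n + 1) ⥤ C) :
    ((systemComplex A C).map τ).f n ≫ cochainπ ((natSystemOf A C).obj T') f =
      cochainπ ((natSystemOf A C).obj T) f ≫ τ.app ⟨SimplexCategory.mk n, f⟩ :=
  thomasonComplex_map_f_π _ _

instance : (systemComplex A C).Additive where
  map_add {T T' τ τ'} := by
    ext n
    refine cochain_ext ((natSystemOf A C).obj T') fun f => ?_
    refine (systemComplex_map_f_π _ f).trans ?_
    refine Eq.trans ?_ (Preadditive.add_comp _ _ _ _ _ _).symm
    refine Eq.trans ?_ (congrArg₂ (· + ·) (systemComplex_map_f_π _ f)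
      (systemComplex_map_f_π _ f)).symm
    exact Preadditive.comp_add _ _ _ _ _ _

variable (C) in
/-- The `n`-simplices of `C`, as a functor on a discrete category. -/
abbrev simplices (n : ℕ) : Discrete (Fin (n + 1) ⥤ C) ⥤ SimplexCat C :=
  Discrete.functor fun f => ⟨SimplexCategory.mk n, f⟩

/-- The values of a natural system on the `n`-simplices. -/
def simplicesCompIso (n : ℕ) (T : SimplexCat C ⥤ A) :
    (Discrete.functor fun f : Fin (n + 1) ⥤ C => T.obj ⟨SimplexCategory.mk n, f⟩) ≅
      simplices C n ⋙ T :=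
  Discrete.natIso fun _ => Iso.refl _

/-- The `n`-th cochains as a limit over a discrete category. -/
def systemComplexXIso (n : ℕ) (T : SimplexCat C ⥤ A) :
    ((systemComplex A C).obj T).X n ≅ lim.obj (simplices C n ⋙ T) :=
  lim.mapIso (simplicesCompIso n T)

theorem systemComplexXIso_hom_π (n : ℕ) (T : SimplexCat C ⥤ A) (f : Fin (n + 1) ⥤ C) :
    (systemComplexXIso n T).hom ≫ limit.π (simplices C n ⋙ T) (Discrete.mk f) =
      cochainπ ((natSystemOf A C).obj T) f := by
  refine (limMap_π (simplicesCompIso n T).hom _).trans ?_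
  exact Category.comp_id _

variable (A C) in
/-- The `n`-th cochains as a composite of a restriction functor and a product functor. -/
def systemComplexEvalIso (n : ℕ) :
    systemComplex A C ⋙ HomologicalComplex.eval A (ComplexShape.up ℕ) n ≅
      (Functor.whiskeringLeft _ _ A).obj (simplices C n) ⋙ lim :=
  NatIso.ofComponents (systemComplexXIso n) (fun {T T'} τ => by
    refine limit.hom_ext fun f => ?_
    refine (Category.assoc _ _ _).trans
      ((congrArg (_ ≫ ·) (systemComplexXIso_hom_π n T' f.as)).trans ?_)
    refine (systemComplex_map_f_π τ f.as).trans ?_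
    refine Eq.symm ((Category.assoc _ _ _).trans ((congrArg (_ ≫ ·) (limMap_π _ _)).trans ?_))
    exact (Category.assoc _ _ _).symm.trans
      (congrArg (· ≫ τ.app _) (systemComplexXIso_hom_π n T f.as)))

section Exact

variable [AB4Star A]

/-- This is where exactness of products enters. In each degree the cochains are a restriction to the
discrete category of `n`-simplices, which is exact, followed by a product. -/
theorem systemComplex_shortExact {S : ShortComplex (SimplexCat C ⥤ A)} (hS : S.ShortExact) :
    (S.map (systemComplex A C)).ShortExact := by
  refine HomologicalComplex.shortExact_of_degreewise_shortExact _ fun n => ?_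
  have h : PreservesFiniteLimits
      (systemComplex A C ⋙ HomologicalComplex.eval A (ComplexShape.up ℕ) n) :=
    preservesFiniteLimits_of_natIso (systemComplexEvalIso A C n).symm
  have h' : PreservesFiniteColimits
      (systemComplex A C ⋙ HomologicalComplex.eval A (ComplexShape.up ℕ) n) :=
    preservesFiniteColimits_of_natIso (systemComplexEvalIso A C n).symm
  exact hS.map_of_exact (systemComplex A C ⋙ HomologicalComplex.eval A (ComplexShape.up ℕ) n)

variable (A C) in
/-- Thomason cohomology of the natural systems on a fixed category, as a δ-functor. -/
def thomasonDelta : DeltaFunctor (SimplexCat C ⥤ A) A where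
  F n := systemComplex A C ⋙ HomologicalComplex.homologyFunctor A (ComplexShape.up ℕ) n
  additive n := inferInstance
  δ n S hS := (systemComplex_shortExact hS).δ n (n + 1) rfl
  δ_naturality n {S S'} hS hS' φ := (HomologicalComplex.HomologySequence.δ_naturality
    ((systemComplex A C).mapShortComplex.map φ) (systemComplex_shortExact hS)
    (systemComplex_shortExact hS') n (n + 1) rfl).symm
  map_comp_δ n S hS := (systemComplex_shortExact hS).comp_δ n (n + 1) rfl
  δ_comp_map n S hS := (systemComplex_shortExact hS).δ_comp n (n + 1) rfl
  -- No differential enters degree 0, so `H⁰` is a subobject of the `0`-cochains and preserves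
  -- monomorphisms.
  mono S hS := by
    have := (systemComplex_shortExact hS).mono_f
    exact HomologicalComplex.mono_homologyMap_of_mono_of_not_rel (S.map (systemComplex A C)).f 0
      fun i => Nat.succ_ne_zero i
  exact₂ n S hS := (systemComplex_shortExact hS).homology_exact₂ n
  exact₃ n S hS := (systemComplex_shortExact hS).homology_exact₃ n (n + 1) rfl
  exact₁ n S hS := (systemComplex_shortExact hS).homology_exact₁ n (n + 1) rfl

end Exact

end ThomasonComplex

/-! ### Coinduced functors. -/

section Coinduced

variable {A : Type u} [Category.{w} A] [HasProducts.{w} A] {D : Type w} [SmallCategory D]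

/-- The functor `c ↦ ∏_{c ⟶ d} T d`, coinduced from the objects of `D`. -/
def coindObj (T : D ⥤ A) : D ⥤ A where
  obj c := ∏ᶜ fun p : (Σ d : D, c ⟶ d) => T.obj p.1
  map {c c'} s := Pi.lift fun p : (Σ d : D, c' ⟶ d) =>
    Pi.π (fun p : (Σ d : D, c ⟶ d) => T.obj p.1) ⟨p.1, s ≫ p.2⟩
  map_id c := by
    refine Pi.hom_ext _ _ fun ⟨d, s⟩ => ?_
    simp only [Category.id_comp, limit.lift_π, Fan.mk_π_app]
    -- The target `T.obj d` depends only on the first component of the index. With `d` fixed, the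
    -- projection is an ordinary function of the arrow, and the category axiom can be applied to its
    -- argument without transport.
    let q (t : c ⟶ d) : (∏ᶜ fun p : (Σ d : D, c ⟶ d) => T.obj p.1) ⟶ T.obj d :=
      Pi.π (fun p : (Σ d : D, c ⟶ d) => T.obj p.1) ⟨d, t⟩
    exact congrArg q (Category.id_comp s)
  map_comp {c _ _} s t := by
    refine Pi.hom_ext _ _ fun ⟨d, r⟩ => ?_
    simp only [Category.assoc, limit.lift_π, Fan.mk_π_app]
    let q (t : c ⟶ d) : (∏ᶜ fun p : (Σ d : D, c ⟶ d) => T.obj p.1) ⟶ T.obj d :=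
      Pi.π (fun p : (Σ d : D, c ⟶ d) => T.obj p.1) ⟨d, t⟩
    exact congrArg q (Category.assoc s t r)

/-- The projection of a coinduced functor. -/
def coindπ (T : D ⥤ A) {c d : D} (s : c ⟶ d) : (coindObj T).obj c ⟶ T.obj d :=
  Pi.π (fun p : (Σ d : D, c ⟶ d) => T.obj p.1) ⟨d, s⟩

theorem coindObj_map_π (T : D ⥤ A) {c c' d : D} (s : c ⟶ c') (t : c' ⟶ d) :
    (coindObj T).map s ≫ coindπ T t = coindπ T (s ≫ t) :=
  Pi.lift_π _ _

theorem coindObj_map_π_assoc (T : D ⥤ A) {c c' d : D} (s : c ⟶ c') (t : c' ⟶ d) {Y : A}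
    (y : T.obj d ⟶ Y) : (coindObj T).map s ≫ coindπ T t ≫ y = coindπ T (s ≫ t) ≫ y := by
  rw [← Category.assoc, coindObj_map_π]

theorem coind_ext (T : D ⥤ A) {c : D} {X : A} {x y : X ⟶ (coindObj T).obj c}
    (h : ∀ (d : D) (s : c ⟶ d), x ≫ coindπ T s = y ≫ coindπ T s) : x = y :=
  Pi.hom_ext _ _ fun p => h p.1 p.2

/-- The morphism into a coinduced functor with given components. -/
def coindLift (T : D ⥤ A) {c : D} {X : A} (x : ∀ (d : D) (_ : c ⟶ d), X ⟶ T.obj d) :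
    X ⟶ (coindObj T).obj c :=
  Pi.lift fun p => x p.1 p.2

@[simp]
theorem coindLift_π (T : D ⥤ A) {c d : D} {X : A} (x : ∀ (d : D) (_ : c ⟶ d), X ⟶ T.obj d)
    (s : c ⟶ d) : coindLift T x ≫ coindπ T s = x d s :=
  Pi.lift_π _ _

@[simp]
theorem coindLift_π_assoc (T : D ⥤ A) {c d : D} {X : A}
    (x : ∀ (d : D) (_ : c ⟶ d), X ⟶ T.obj d) (s : c ⟶ d) {Y : A} (y : T.obj d ⟶ Y) :
    coindLift T x ≫ coindπ T s ≫ y = x d s ≫ y := by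
  rw [← Category.assoc, coindLift_π]

variable (A D) in
/-- Coinduction from the objects of `D`, as a functor. -/
def coind : (D ⥤ A) ⥤ (D ⥤ A) where
  obj T := coindObj T
  map {T T'} τ :=
    { app := fun c => coindLift T' fun d s => coindπ T s ≫ τ.app d
      naturality := fun c c' s => by
        refine coind_ext T' fun d t => ?_
        simp [coindObj_map_π, coindObj_map_π_assoc] }
  map_id T := by
    ext c
    refine coind_ext T fun d s => ?_
    simp
  map_comp {T T' T''} τ τ' := by
    ext c
    refine coind_ext T'' fun d s => ?_
    simp

variable (A D) in
/-- The embedding of a functor into a coinduced functor. -/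
def coindUnit : 𝟭 (D ⥤ A) ⟶ coind A D where
  app T :=
    { app := fun c => coindLift T fun d s => T.map s
      naturality := fun c c' s => by
        refine coind_ext T fun d t => ?_
        simp [coind, coindObj_map_π] }
  naturality T T' τ := by
    ext c
    refine coind_ext T' fun d s => ?_
    simp [coind]

/-- At each `c` the projection at `𝟙 c` is a left inverse. These splittings need not be natural in
`c`, but objectwise monomorphisms suffice. -/
instance (T : D ⥤ A) : Mono ((coindUnit A D).app T) := by
  have h : ∀ c, Mono (((coindUnit A D).app T).app c) := fun c => by
    have h : ((coindUnit A D).app T).app c ≫ coindπ T (𝟙 c) = 𝟙 (T.obj c) :=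
      (coindLift_π T _ _).trans (T.map_id c)
    have h' : Mono (((coindUnit A D).app T).app c ≫ coindπ T (𝟙 c)) := by
      rw [h]
      exact inferInstanceAs (Mono (𝟙 (T.obj c)))
    exact mono_of_mono _ (coindπ T (𝟙 c))
  exact NatTrans.mono_of_mono_app _

end Coinduced

/-! ### Coinduced systems are acyclic. -/

section Acyclic

open SSet.Augmented.StandardSimplex Simplicial

/-- Deleting the prepended vertex restores the simplex. Together with `δ_succ_comp_shift` (deleting
a later vertex commutes with prepending), this is the cone contraction of a standard simplex. It is
used both for coinduced cochains and for the bar resolution. -/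
theorem δ_zero_comp_shift {n : ℕ} {Δ : SimplexCategory} (σ : ⦋n⦌ ⟶ Δ) :
    SimplexCategory.δ 0 ≫ shift σ = σ := by
  ext i : 3
  rfl

theorem δ_succ_comp_shift {n : ℕ} {Δ : SimplexCategory} (σ : ⦋n + 1⦌ ⟶ Δ) (i : Fin (n + 2)) :
    SimplexCategory.δ i.succ ≫ shift σ = shift (SimplexCategory.δ i ≫ σ) := by
  ext j : 3
  cases j using Fin.cases with
  | zero => rfl
  | succ j =>
    change shiftFun _ (i.succ.succAbove j.succ) = σ.toOrderHom (i.succAbove j)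
    rw [Fin.succ_succAbove_succ, shiftFun_succ]

variable {A : Type u} [Category.{w} A] [Abelian A] [HasProducts.{w} A]
  {C : Type w} [SmallCategory C] (T : SimplexCat C ⥤ A)

/-- The projection of the cochains of a coinduced system onto the factor of a simplex over `g`. -/
def coindCochainπ {n : ℕ} (g : SimplexCat C) (σ : ⦋n⦌ ⟶ g.dim) :
    ((systemComplex A C).obj (coindObj T)).X n ⟶ T.obj g :=
  cochainπ ((natSystemOf A C).obj (coindObj T)) (toFunctor σ ⋙ g.simplex) ≫
    coindπ T (SimplexCat.pull σ g.simplex)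

/-- The double product over `f` and over arrows `f ⟶ g` reindexes as a product over `g` and `σ : [n]
⟶ g.dim`: an arrow to `g` is a `σ` with `f = g ∘ σ`, so `f` carries no further information. -/
theorem coindCochain_ext {n : ℕ} {X : A}
    {x y : X ⟶ ((systemComplex A C).obj (coindObj T)).X n}
    (h : ∀ (g : SimplexCat C) (σ : ⦋n⦌ ⟶ g.dim),
      x ≫ coindCochainπ T g σ = y ≫ coindCochainπ T g σ) : x = y := by
  refine cochain_ext ((natSystemOf A C).obj (coindObj T)) fun f => ?_
  refine coind_ext T fun g s => ?_
  obtain ⟨(σ : ⦋n⦌ ⟶ g.dim), (hσ : f = toFunctor σ ⋙ g.simplex)⟩ := s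
  subst hσ
  exact (Category.assoc _ _ _).trans ((h g σ).trans (Category.assoc _ _ _).symm)

/-- The structure maps of a coinduced system only precompose the indexing arrow. The coefficient `T
g` therefore stays fixed, and the differential is that of the simplicial cochains of `Δ[dim g]`. -/
theorem d_coindCochainπ {n : ℕ} (g : SimplexCat C) (σ : ⦋n + 1⦌ ⟶ g.dim) :
    ((systemComplex A C).obj (coindObj T)).d n (n + 1) ≫ coindCochainπ T g σ =
      ∑ i : Fin (n + 2), (-1 : ℤ) ^ (i : ℕ) • coindCochainπ T g (SimplexCategory.δ i ≫ σ) := by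
  refine (Category.assoc _ _ _).symm.trans
    ((congrArg (· ≫ _) (thomasonComplex_d_π ((natSystemOf A C).obj (coindObj T)) _)).trans ?_)
  refine (Preadditive.sum_comp _ _ _).trans (Finset.sum_congr rfl fun i _ => ?_)
  refine (Preadditive.zsmul_comp _ _ _).trans (congrArg _ ?_)
  exact (Category.assoc _ _ _).trans (congrArg (_ ≫ ·) (coindObj_map_π T _ _))

/-- The contraction of the cochains of a coinduced system. -/
def coindContraction (n : ℕ) :
    ((systemComplex A C).obj (coindObj T)).X (n + 1) ⟶
      ((systemComplex A C).obj (coindObj T)).X n :=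
  cochainLift ((natSystemOf A C).obj (coindObj T)) fun _ =>
    -- The cone point is the vertex 0 of `g`. It is not preserved by morphisms of `Δ/C`, which is
    -- harmless here because distinct targets `g` do not interact.
    coindLift T fun g s => coindCochainπ T g (shift (SimplexCat.Hom.map s))

theorem coindContraction_π {n : ℕ} (g : SimplexCat C) (σ : ⦋n⦌ ⟶ g.dim) :
    coindContraction T n ≫ coindCochainπ T g σ = coindCochainπ T g (shift σ) :=
  (cochainLift_π_assoc ((natSystemOf A C).obj (coindObj T)) _ _ _).trans (coindLift_π T _ _)

/-- In the second composite, the face `δ 0` of `shift σ` contributes `σ` itself. The faces `δ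
i.succ` contribute the terms of the first composite with the opposite sign and cancel them. -/
theorem coindContraction_add (n : ℕ) :
    coindContraction T n ≫ ((systemComplex A C).obj (coindObj T)).d n (n + 1) +
      ((systemComplex A C).obj (coindObj T)).d (n + 1) (n + 2) ≫ coindContraction T (n + 1) =
      𝟙 _ := by
  refine coindCochain_ext T fun g σ => ?_
  rw [Preadditive.add_comp, Category.assoc, Category.assoc, d_coindCochainπ, coindContraction_π,
    d_coindCochainπ, Preadditive.comp_sum, Category.id_comp, Fin.sum_univ_succ (n := n + 2)]
  simp only [Preadditive.comp_zsmul, coindContraction_π, δ_succ_comp_shift, δ_zero_comp_shift,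
    Fin.val_zero, pow_zero, one_smul, Fin.val_succ, pow_succ, mul_neg, mul_one, neg_smul,
    Finset.sum_neg_distrib]
  abel

theorem isZero_homology_coind (n : ℕ) :
    IsZero (((systemComplex A C).obj (coindObj T)).homology (n + 1)) := by
  refine HomologicalComplex.ExactAt.isZero_homology ?_
  rw [HomologicalComplex.exactAt_iff' _ n (n + 1) (n + 2) (by simp) (by simp),
    ShortComplex.exact_iff_exact_up_to_refinements]
  intro X x hx
  have hx' : x ≫ ((systemComplex A C).obj (coindObj T)).d (n + 1) (n + 2) = 0 := hx
  -- No refinement of `X` is needed: the contraction applied to the cocycle is a primitive.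
  refine ⟨X, 𝟙 X, inferInstance, x ≫ coindContraction T n, ?_⟩
  have h := congrArg (x ≫ ·) (coindContraction_add T n)
  refine (Category.id_comp x).trans (Eq.trans ?_ (Category.assoc _ _ _).symm)
  refine (Category.comp_id x).symm.trans (h.symm.trans ?_)
  refine (Preadditive.comp_add _ _ _ _ _ _).trans ?_
  refine (congrArg (x ≫ coindContraction T n ≫ _ + ·) ((Category.assoc _ _ _).symm.trans
    ((congrArg (· ≫ coindContraction T (n + 1)) hx').trans zero_comp))).trans ?_
  exact add_zero _

variable (A C) in
/-- The effacement of Thomason cohomology by coinduced systems. -/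
def thomasonEffacement [AB4Star A] : (thomasonDelta A C).Effacement where
  J := coind A (SimplexCat C)
  η := coindUnit A (SimplexCat C)
  mono _ := inferInstance
  isZero n T := isZero_homology_coind T n

end Acyclic

/-! ### Degree zero: cocycles are compatible families. -/

section DegreeZero

open Simplicial

variable {A : Type u} [Category.{w} A] [Abelian A]

section

variable [HasProducts.{w} A] {C : Type w} [SmallCategory C] (T : SimplexCat C ⥤ A)

/-- The component at `g` of a `0`-cochain, through a vertex of `g`. -/
def vertexπ (g : SimplexCat C) (σ : ⦋0⦌ ⟶ g.dim) :
    ((systemComplex A C).obj T).X 0 ⟶ T.obj g :=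
  cochainπ ((natSystemOf A C).obj T) (toFunctor σ ⋙ g.simplex) ≫
    T.map (SimplexCat.pull σ g.simplex)

/-- The arrow `s` forces `g = g' ∘ ρ`. After this substitution, both sides push the same `0`-simplex
forward, by functoriality of `T`. -/
theorem vertexπ_map {g g' : SimplexCat C} (s : g ⟶ g') (σ : ⦋0⦌ ⟶ g.dim) :
    vertexπ T g σ ≫ T.map s = vertexπ T g' (σ ≫ SimplexCat.Hom.map s) := by
  obtain ⟨n, g⟩ := g
  obtain ⟨(ρ : n ⟶ g'.dim), (hρ : g = toFunctor ρ ⋙ g'.simplex)⟩ := s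
  subst hρ
  refine (Category.assoc _ _ _).trans (congrArg (_ ≫ ·) ?_)
  exact (T.map_comp _ _).symm

theorem vertexπ_id (f : Fin (0 + 1) ⥤ C) (σ : ⦋0⦌ ⟶ ⦋0⦌) :
    vertexπ T ⟨⦋0⦌, f⟩ σ = cochainπ ((natSystemOf A C).obj T) f := by
  obtain rfl : σ = 𝟙 _ := Subsingleton.elim _ _
  exact (congrArg (_ ≫ ·) (T.map_id _)).trans (Category.comp_id _)

theorem d_edge (g : SimplexCat C) (e : ⦋1⦌ ⟶ g.dim) :
    ((systemComplex A C).obj T).d 0 1 ≫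
      cochainπ ((natSystemOf A C).obj T) (toFunctor e ⋙ g.simplex) ≫
        T.map (SimplexCat.pull e g.simplex) =
      vertexπ T g (SimplexCategory.δ 0 ≫ e) - vertexπ T g (SimplexCategory.δ 1 ≫ e) := by
  have h := thomasonComplex_d_π ((natSystemOf A C).obj T) (n := 0) (toFunctor e ⋙ g.simplex)
  rw [Fin.sum_univ_two] at h
  have key : ∀ i : Fin 2, (cochainπ ((natSystemOf A C).obj T)
      (toFunctor (SimplexCategory.δ i) ⋙ toFunctor e ⋙ g.simplex) ≫
        T.map (SimplexCat.pull (SimplexCategory.δ i) (toFunctor e ⋙ g.simplex))) ≫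
        T.map (SimplexCat.pull e g.simplex) = vertexπ T g (SimplexCategory.δ i ≫ e) := fun i =>
    vertexπ_map T (SimplexCat.pull e g.simplex) (SimplexCategory.δ i)
  rw [sub_eq_add_neg, ← key 0, ← key 1]
  refine (Category.assoc _ _ _).symm.trans ((congrArg (· ≫ _) h).trans ?_)
  refine (Preadditive.add_comp _ _ _ _ _ _).trans (congrArg₂ (· + ·) ?_ ?_)
  · refine congrArg (· ≫ _) ?_
    simp
    rfl
  · refine Eq.trans ?_ (Preadditive.neg_comp _ _)
    refine congrArg (· ≫ _) ?_
    simp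
    rfl

/-- The vertices of a simplex are totally ordered, so any two of them are the ends of an edge, and
`d_edge` equates the two values of a cocycle. -/
theorem cocycle_vertexπ_eq {X : A} (x : X ⟶ ((systemComplex A C).obj T).X 0)
    (hx : x ≫ ((systemComplex A C).obj T).d 0 1 = 0) (g : SimplexCat C) (σ τ : ⦋0⦌ ⟶ g.dim) :
    x ≫ vertexπ T g σ = x ≫ vertexπ T g τ := by
  have key : ∀ i j : Fin (g.dim.len + 1), i ≤ j →
      x ≫ vertexπ T g (SimplexCategory.const ⦋0⦌ g.dim i) =
        x ≫ vertexπ T g (SimplexCategory.const ⦋0⦌ g.dim j) := fun i j hij => by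
    have h := congrArg (x ≫ ·) (d_edge T g (SimplexCategory.mkOfLe i j hij))
    -- The face `δ 0` omits the initial vertex of the edge, so it picks out its end `j`; `δ 1` picks
    -- out `i`.
    have h₁ : SimplexCategory.δ 0 ≫ SimplexCategory.mkOfLe i j hij =
        SimplexCategory.const ⦋0⦌ g.dim j := by
      ext k : 3
      fin_cases k
      rfl
    have h₂ : SimplexCategory.δ 1 ≫ SimplexCategory.mkOfLe i j hij =
        SimplexCategory.const ⦋0⦌ g.dim i := by
      ext k : 3
      fin_cases k
      rfl
    rw [h₁, h₂] at h
    dsimp only at h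
    rw [Preadditive.comp_sub, ← Category.assoc, hx, zero_comp] at h
    exact (sub_eq_zero.1 h.symm).symm
  rw [SimplexCategory.eq_const_of_zero σ, SimplexCategory.eq_const_of_zero τ]
  rcases le_total (σ.toOrderHom 0) (τ.toOrderHom 0) with h | h
  · exact key _ _ h
  · exact (key _ _ h).symm

end

variable [HasLimits A]

/-- The compatible family of a limit as a `0`-cochain. -/
def limitToCochain (S : NatSystem A) :
    limit S.system ⟶ ((thomasonComplex A).obj S).X 0 :=
  cochainLift S fun f => limit.π S.system ⟨⦋0⦌, f⟩

theorem limitToCochain_vertexπ (S : NatSystem A) (g : SimplexCat S.base) (σ : ⦋0⦌ ⟶ g.dim) :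
    limitToCochain S ≫ vertexπ S.system g σ = limit.π S.system g :=
  (cochainLift_π_assoc S _ _ _).trans (limit.w S.system (SimplexCat.pull σ g.simplex))

theorem limitToCochain_d (S : NatSystem A) :
    limitToCochain S ≫ ((thomasonComplex A).obj S).d 0 1 = 0 := by
  refine cochain_ext S fun g => ?_
  -- The edge formula is taken at the tautological edge of the `1`-simplex `g`. Both of its vertices
  -- contribute the same limit projection.
  have h := congrArg (limitToCochain S ≫ ·) (d_edge S.system ⟨⦋1⦌, g⟩ (𝟙 _))
  have e : S.system.map (SimplexCat.pull (𝟙 ⦋1⦌) g) = 𝟙 _ := S.system.map_id _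
  refine Eq.trans ?_ (h.trans ?_)
  · refine (Category.assoc _ _ _).trans (congrArg (limitToCochain S ≫ ·) ?_)
    refine congrArg (_ ≫ ·) ?_
    exact ((congrArg (_ ≫ ·) e).trans (Category.comp_id _)).symm
  · refine (Preadditive.comp_sub _ _ _).trans ?_
    refine (sub_eq_zero.2 ?_).trans zero_comp.symm
    exact (limitToCochain_vertexπ S _ _).trans (limitToCochain_vertexπ S _ _).symm

/-- The `0`-cocycles of the Thomason complex map to the limit. -/
def cocyclesToLimit (S : NatSystem A) :
    ((thomasonComplex A).obj S).cycles 0 ⟶ limit S.system :=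
  limit.lift S.system
    { pt := ((thomasonComplex A).obj S).cycles 0
      π :=
        { app := fun g => ((thomasonComplex A).obj S).iCycles 0 ≫
            -- Vertex 0 is an arbitrary choice. Morphisms of `Δ/C` need not preserve it, and
            -- independence of the vertex for cocycles is what makes the family compatible.
            vertexπ S.system g (SimplexCategory.const ⦋0⦌ g.dim 0)
          naturality := fun g g' s => by
            refine (Category.id_comp _).trans (Eq.symm ((Category.assoc _ _ _).trans ?_))
            refine (congrArg (_ ≫ ·) (vertexπ_map S.system s _)).trans ?_
            exact cocycle_vertexπ_eq S.system _
              (((thomasonComplex A).obj S).iCycles_d 0 1) g' _ _ } }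

theorem cocyclesToLimit_π (S : NatSystem A) (g : SimplexCat S.base) (σ : ⦋0⦌ ⟶ g.dim) :
    cocyclesToLimit S ≫ limit.π S.system g =
      ((thomasonComplex A).obj S).iCycles 0 ≫ vertexπ S.system g σ :=
  (limit.lift_π _ _).trans (cocycle_vertexπ_eq S.system _
    (((thomasonComplex A).obj S).iCycles_d 0 1) g _ _)

/-- The `0`-cocycles of the Thomason complex are the limit. -/
def limitIsoCocycles (S : NatSystem A) :
    limit S.system ≅ ((thomasonComplex A).obj S).cycles 0 where
  hom := ((thomasonComplex A).obj S).liftCycles (limitToCochain S) 1 (by simp) (limitToCochain_d S)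
  inv := cocyclesToLimit S
  hom_inv_id := by
    refine limit.hom_ext fun g => ?_
    rw [Category.assoc, cocyclesToLimit_π S g (SimplexCategory.const ⦋0⦌ g.dim 0),
      Category.id_comp]
    refine (Category.assoc _ _ _).symm.trans
      ((congrArg (· ≫ _) (HomologicalComplex.liftCycles_i _ _ _ _ _)).trans ?_)
    exact limitToCochain_vertexπ S g _
  inv_hom_id := by
    rw [← cancel_mono (((thomasonComplex A).obj S).iCycles 0), Category.assoc,
      HomologicalComplex.liftCycles_i, Category.id_comp]
    refine cochain_ext S fun f => ?_
    refine (Category.assoc _ _ _).trans ((congrArg (_ ≫ ·) (cochainLift_π S _ f)).trans ?_)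
    refine (cocyclesToLimit_π S ⟨⦋0⦌, f⟩ (𝟙 _)).trans ?_
    exact congrArg (_ ≫ ·) (vertexπ_id S.system f _)

theorem limitToCochain_naturality {S T : NatSystem A} (a : S ⟶ T) :
    limitToCochain S ≫ ((thomasonComplex A).map a).f 0 =
      (limit.pre S.system (SimplexCat.mapFunctor a.functor) ≫ limMap a.trans) ≫
        limitToCochain T := by
  refine cochain_ext T fun f => ?_
  refine (Category.assoc _ _ _).trans ((congrArg (_ ≫ ·) (thomasonComplex_map_f_π a f)).trans ?_)
  refine (Category.assoc _ _ _).symm.trans ((congrArg (· ≫ _) (cochainLift_π S _ _)).trans ?_)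
  refine Eq.symm ((Category.assoc _ _ _).trans ((congrArg (_ ≫ ·) (cochainLift_π T _ _)).trans ?_))
  refine (Category.assoc _ _ _).trans ((congrArg (_ ≫ ·) (limMap_π _ _)).trans ?_)
  exact (Category.assoc _ _ _).symm.trans (congrArg (· ≫ _) (limit.pre_π _ _ _))

/-- Thomason cohomology in degree `0` is the limit. -/
def limitIsoCohomology (S : NatSystem A) :
    limit S.system ≅ (thomasonCohomology A 0).obj S :=
  limitIsoCocycles S ≪≫ CochainComplex.isoHomologyπ₀ _

theorem limitIsoCohomology_naturality {S T : NatSystem A} (a : S ⟶ T) :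
    (limitIsoCohomology S).hom ≫ (thomasonCohomology A 0).map a =
      (limit.pre S.system (SimplexCat.mapFunctor a.functor) ≫ limMap a.trans) ≫
        (limitIsoCohomology T).hom := by
  have h : (limitIsoCocycles S).hom ≫
      HomologicalComplex.cyclesMap ((thomasonComplex A).map a) 0 =
      (limit.pre S.system (SimplexCat.mapFunctor a.functor) ≫ limMap a.trans) ≫
        (limitIsoCocycles T).hom := by
    rw [← cancel_mono (((thomasonComplex A).obj T).iCycles 0)]
    simp only [Category.assoc, HomologicalComplex.cyclesMap_i, limitIsoCocycles,
      HomologicalComplex.liftCycles_i, HomologicalComplex.liftCycles_i_assoc]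
    exact (limitToCochain_naturality a).trans (Category.assoc _ _ _)
  have h' : ((thomasonComplex A).obj S).homologyπ 0 ≫
      HomologicalComplex.homologyMap ((thomasonComplex A).map a) 0 =
      HomologicalComplex.cyclesMap ((thomasonComplex A).map a) 0 ≫
        ((thomasonComplex A).obj T).homologyπ 0 :=
    HomologicalComplex.homologyπ_naturality _ _
  refine (Category.assoc _ _ _).trans ((congrArg (_ ≫ ·) h').trans ?_)
  refine (Category.assoc _ _ _).symm.trans ((congrArg (· ≫ _) h).trans ?_)
  exact Category.assoc _ _ _

end DegreeZero

/-! ### Uniqueness of right derived functors. -/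

section Uniqueness

variable {𝓐 : Type u₁} [Category.{v₁} 𝓐] [Abelian 𝓐] {𝓑 : Type u₂} [Category.{v₂} 𝓑] [Abelian 𝓑]

namespace DeltaFunctor

/-- The identity morphism of a δ-functor. -/
def Hom.id (F : DeltaFunctor 𝓐 𝓑) : Hom F F where
  app _ := 𝟙 _
  comm _ _ _ := (Category.comp_id _).trans (Category.id_comp _).symm

/-- The composition of morphisms of δ-functors. -/
def Hom.comp {F G H : DeltaFunctor 𝓐 𝓑} (φ : Hom F G) (ψ : Hom G H) : Hom F H where
  app n := φ.app n ≫ ψ.app n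
  comm n S hS := by
    rw [NatTrans.comp_app, NatTrans.comp_app, ← Category.assoc, φ.comm, Category.assoc, ψ.comm,
      Category.assoc]

/-- The restriction of a morphism of δ-functors along an exact functor. -/
def Hom.precomp {𝓒 : Type u₃} [Category.{v₃} 𝓒] [Abelian 𝓒] (E : 𝓒 ⥤ 𝓐) [E.Additive]
    [PreservesFiniteLimits E] [PreservesFiniteColimits E] {F G : DeltaFunctor 𝓐 𝓑}
    (φ : Hom F G) : Hom (F.precomp E) (G.precomp E) where
  app n := Functor.whiskerLeft E (φ.app n)
  comm n S hS := φ.comm n (S.map E) (hS.map_of_exact E)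

end DeltaFunctor

namespace RightDerived

variable {L : 𝓐 ⥤ 𝓑}

/-- The morphism of δ-functors between two choices of the right derived functors. -/
def comparison (R R' : RightDerived L) : DeltaFunctor.Hom R.delta R'.delta :=
  R.universal.lift _ (R.iso.hom ≫ R'.iso.inv)

theorem comparison_zero (R R' : RightDerived L) :
    (comparison R R').app 0 = R.iso.hom ≫ R'.iso.inv :=
  R.universal.lift_zero _ _

/-- Both sides are endomorphisms of a universal δ-functor that are the identity in degree 0. -/
theorem comparison_comp (R R' : RightDerived L) :
    (comparison R R').comp (comparison R' R) = DeltaFunctor.Hom.id R.delta := by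
  refine R.universal.hom_ext ?_
  refine (congrArg₂ (· ≫ ·) (comparison_zero R R') (comparison_zero R' R)).trans ?_
  simp
  rfl

/-- The right derived functors are unique. -/
def uniqueIso (R R' : RightDerived L) (n : ℕ) : R.delta.F n ≅ R'.delta.F n where
  hom := (comparison R R').app n
  inv := (comparison R' R).app n
  hom_inv_id := congrArg (fun φ => DeltaFunctor.Hom.app φ n) (comparison_comp R R')
  inv_hom_id := congrArg (fun φ => DeltaFunctor.Hom.app φ n) (comparison_comp R' R)

end RightDerived

end Uniqueness

/-! ### Thomason cohomology computes the derived limits. -/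

section DerivedLimit

variable {A : Type u} [Category.{w} A] [Abelian A] [HasLimits A] [AB4Star A]

variable (A) in
/-- Thomason cohomology computes the derived limits. -/
def thomasonRightDerived (C : Type w) [SmallCategory C] :
    RightDerived (lim : (SimplexCat C ⥤ A) ⥤ A) where
  delta := thomasonDelta A C
  universal := (thomasonEffacement A C).isUniversal
  iso := Iso.symm <| NatIso.ofComponents
    (fun T => limitIsoCohomology ((natSystemOf A C).obj T)) fun {T T'} τ => by
      refine Eq.symm ((limitIsoCohomology_naturality ((natSystemOf A C).map τ)).trans ?_)
      refine congrArg (· ≫ _) (limit.hom_ext fun f => ?_)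
      refine (Category.assoc _ _ _).trans ((congrArg (_ ≫ ·) (limMap_π _ _)).trans ?_)
      refine (Category.assoc _ _ _).symm.trans ((congrArg (· ≫ _) (limit.pre_π _ _ _)).trans ?_)
      exact (limMap_π τ f).symm

/-- The restriction of Thomason cohomology along a functor, as a morphism of δ-functors. -/
def thomasonRestrict {C₁ : Type w} [SmallCategory C₁] {C₂ : Type w} [SmallCategory C₂]
    (φ : C₂ ⥤ C₁) : DeltaFunctor.Hom (thomasonDelta A C₁)
      ((thomasonDelta A C₂).precomp
        ((Functor.whiskeringLeft _ _ A).obj (SimplexCat.mapFunctor φ))) where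
  app n :=
    { app := fun T => (thomasonCohomology A n).map (restrictHom φ T)
      naturality := fun T T' τ => by
        refine ((thomasonCohomology A n).map_comp _ _).symm.trans ?_
        refine (congrArg _ (natSystemOf_map_restrictHom φ τ)).trans ?_
        exact (thomasonCohomology A n).map_comp _ _ }
  comm n S hS := by
    let E := (Functor.whiskeringLeft _ _ A).obj (SimplexCat.mapFunctor φ)
    let ρ : S.map (systemComplex A C₁) ⟶ (S.map E).map (systemComplex A C₂) :=
      { τ₁ := (thomasonComplex A).map (restrictHom φ S.X₁)
        τ₂ := (thomasonComplex A).map (restrictHom φ S.X₂)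
        τ₃ := (thomasonComplex A).map (restrictHom φ S.X₃)
        comm₁₂ := by
          refine ((thomasonComplex A).map_comp _ _).symm.trans ?_
          refine (congrArg _ (natSystemOf_map_restrictHom φ S.f).symm).trans ?_
          exact (thomasonComplex A).map_comp _ _
        comm₂₃ := by
          refine ((thomasonComplex A).map_comp _ _).symm.trans ?_
          refine (congrArg _ (natSystemOf_map_restrictHom φ S.g).symm).trans ?_
          exact (thomasonComplex A).map_comp _ _ }
    exact HomologicalComplex.HomologySequence.δ_naturality ρ (systemComplex_shortExact hS)
      (systemComplex_shortExact (hS.map_of_exact E)) n (n + 1) rfl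

/-- Both composites start at a universal δ-functor, so they agree once they agree in degree 0. There
`limitIsoCohomology_naturality` turns restriction of cohomology into restriction of limits,
`limit.pre`. -/
theorem comparison_restrict (L : DerivedLimits A) {C₁ : Type w} [SmallCategory C₁]
    {C₂ : Type w} [SmallCategory C₂] (φ : C₂ ⥤ C₁) :
    ((thomasonRightDerived A C₁).comparison (L C₁)).comp
        (limRestrict (SimplexCat.mapFunctor φ) (L C₁) (L C₂)) =
      (thomasonRestrict φ).comp (((thomasonRightDerived A C₂).comparison (L C₂)).precomp
        ((Functor.whiskeringLeft _ _ A).obj (SimplexCat.mapFunctor φ))) := by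
  refine (thomasonRightDerived A C₁).universal.hom_ext (NatTrans.ext (funext fun T => ?_))
  have h₁ := congrArg (fun γ => NatTrans.app γ T)
    ((thomasonRightDerived A C₁).comparison_zero (L C₁))
  have h₂ := congrArg (fun γ => NatTrans.app γ (SimplexCat.mapFunctor φ ⋙ T))
    ((thomasonRightDerived A C₂).comparison_zero (L C₂))
  refine (congrArg₂ (· ≫ ·) h₁ (limRestrict_zero _ _ _ T)).trans ?_
  refine Eq.trans ?_ (congrArg (_ ≫ ·) h₂).symm
  refine (Category.assoc _ _ _).trans ((congrArg (_ ≫ ·)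
    ((L C₁).iso.inv_hom_id_app_assoc T _)).trans ?_)
  refine (Category.assoc _ _ _).symm.trans (Eq.trans ?_ (Category.assoc _ _ _))
  refine congrArg (· ≫ _) ?_
  refine (Iso.inv_comp_eq (limitIsoCohomology ((natSystemOf A C₁).obj T))).2 ?_
  have h := limitIsoCohomology_naturality (restrictHom φ T)
  refine Eq.trans ?_ (Category.assoc _ _ _)
  refine Eq.trans ?_ (congrArg (· ≫ _) h).symm
  refine Eq.symm ((Category.assoc _ _ _).trans ((congrArg (_ ≫ ·) (Iso.hom_inv_id _)).trans ?_))
  refine (Category.comp_id _).trans (limit.hom_ext fun f => ?_)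
  refine (Category.assoc _ _ _).trans ((congrArg (_ ≫ ·) (limMap_π _ _)).trans ?_)
  exact congrArg (_ ≫ ·) (Category.comp_id _)

/-- Thomason cohomology is isomorphic to the derived limits, naturally in the natural system. -/
def thomasonIsoDerivedLimits (L : DerivedLimits A) (n : ℕ) :
    thomasonCohomology A n ≅ L.functor n :=
  NatIso.ofComponents
    (fun S => ((thomasonRightDerived A S.base).uniqueIso (L S.base) n).app S.system)
    fun {S T} a => by
      -- The naturality square of `(φ, τ)` is pasted from two squares: `h` for the restriction along
      -- `φ`, and `h'` for `τ` over the fixed category.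
      have h := congrArg (fun γ => (DeltaFunctor.Hom.app γ n).app S.system)
        (comparison_restrict L a.functor)
      have h' := (((thomasonRightDerived A T.base).comparison (L T.base)).app n).naturality a.trans
      refine (congrArg (fun b => (thomasonCohomology A n).map b ≫ _)
        (restrictHom_comp a).symm).trans ?_
      refine (congrArg (· ≫ _) ((thomasonCohomology A n).map_comp _ _)).trans ?_
      refine (Category.assoc _ _ _).trans ((congrArg (_ ≫ ·) h').trans ?_)
      refine (Category.assoc _ _ _).symm.trans ((congrArg (· ≫ _) h.symm).trans ?_)
      exact Category.assoc _ _ _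

end DerivedLimit

/-! ### The bar resolution of the constant functor `ℤ`. -/

section Bar

open SSet.Augmented.StandardSimplex Simplicial

variable {C : Type w} [SmallCategory C]

variable (C) in
/-- The functor `f ↦ ℤ Δ(n, dim f)` on the simplex category of `C`. -/
def barObj (n : SimplexCategory) : SimplexCat C ⥤ AddCommGrpCat.{w} where
  -- The hom sets of the simplex category live in universe 0 and are lifted to `w`.
  obj f := AddCommGrpCat.of (FreeAbelianGroup (ULift.{w} (n ⟶ f.dim)))
  map s := AddCommGrpCat.ofHom
    (FreeAbelianGroup.map fun σ => ULift.up (σ.down ≫ SimplexCat.Hom.map s))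
  map_id f := by
    refine AddCommGrpCat.hom_ext (FreeAbelianGroup.lift_ext _ _ fun σ => ?_)
    refine (FreeAbelianGroup.map_of_apply _).trans ?_
    exact congrArg (fun τ => FreeAbelianGroup.of (ULift.up τ)) (Category.comp_id σ.down)
  map_comp s t := by
    refine AddCommGrpCat.hom_ext (FreeAbelianGroup.lift_ext _ _ fun σ => ?_)
    refine (FreeAbelianGroup.map_of_apply _).trans (Eq.symm ?_)
    refine (congrArg (FreeAbelianGroup.map _) (FreeAbelianGroup.map_of_apply _)).trans ?_
    refine (FreeAbelianGroup.map_of_apply _).trans ?_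
    exact congrArg (fun τ => FreeAbelianGroup.of (ULift.up τ)) (Category.assoc _ _ _)

/-- The generator of `barObj` given by a simplex of a standard simplex. -/
def barGen {n : SimplexCategory} {g : SimplexCat C} (σ : n ⟶ g.dim) : (barObj C n).obj g :=
  FreeAbelianGroup.of (ULift.up.{w} σ)

theorem barObj_obj_hom_ext {n : SimplexCategory} {g : SimplexCat C} {G : AddCommGrpCat.{w}}
    {a b : (barObj C n).obj g ⟶ G} (h : ∀ σ : n ⟶ g.dim, a (barGen σ) = b (barGen σ)) : a = b :=
  AddCommGrpCat.hom_ext (FreeAbelianGroup.lift_ext _ _ fun σ => h σ.down)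

theorem barObj_map_gen {n : SimplexCategory} {g g' : SimplexCat C} (s : g ⟶ g')
    (σ : n ⟶ g.dim) : (barObj C n).map s (barGen σ) = barGen (σ ≫ SimplexCat.Hom.map s) :=
  FreeAbelianGroup.map_of_apply _

/-- The natural transformation out of `barObj` given by elements. -/
def barDesc {n : SimplexCategory} (M : SimplexCat C ⥤ AddCommGrpCat.{w})
    (y : ∀ f : Fin (n.len + 1) ⥤ C, M.obj ⟨n, f⟩) : barObj C n ⟶ M where
  app g := AddCommGrpCat.ofHom (FreeAbelianGroup.lift fun σ =>
    M.map (SimplexCat.pull σ.down g.simplex) (y (toFunctor σ.down ⋙ g.simplex)))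
  naturality g g' s := by
    -- Once the source simplex is replaced by `g' ∘ ρ`, the elements of `y` on the two sides have
    -- the same index and functoriality of `M` applies.
    obtain ⟨m, g⟩ := g
    obtain ⟨(ρ : m ⟶ g'.dim), (hρ : g = toFunctor ρ ⋙ g'.simplex)⟩ := s
    subst hρ
    refine barObj_obj_hom_ext fun σ => ?_
    refine (congrArg (FreeAbelianGroup.lift _) (barObj_map_gen _ σ)).trans ?_
    refine (FreeAbelianGroup.lift_apply_of _ _).trans (Eq.symm ?_)
    refine (congrArg (M.map _) (FreeAbelianGroup.lift_apply_of _ _)).trans ?_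
    exact (ConcreteCategory.congr_hom (M.map_comp _ _) _).symm

theorem barDesc_gen {n : SimplexCategory} (M : SimplexCat C ⥤ AddCommGrpCat.{w})
    (y : ∀ f : Fin (n.len + 1) ⥤ C, M.obj ⟨n, f⟩) (g : SimplexCat C) (σ : n ⟶ g.dim) :
    (barDesc M y).app g (barGen σ) =
      M.map (SimplexCat.pull σ g.simplex) (y (toFunctor σ ⋙ g.simplex)) :=
  FreeAbelianGroup.lift_apply_of _ _

theorem barDesc_gen_id {n : SimplexCategory} (M : SimplexCat C ⥤ AddCommGrpCat.{w})
    (y : ∀ f : Fin (n.len + 1) ⥤ C, M.obj ⟨n, f⟩) (f : Fin (n.len + 1) ⥤ C) :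
    (barDesc M y).app ⟨n, f⟩ (barGen (g := ⟨n, f⟩) (𝟙 n)) = y f :=
  (barDesc_gen M y ⟨n, f⟩ (𝟙 n)).trans (ConcreteCategory.congr_hom (M.map_id _) _)

/-- Yoneda: the generator `σ` at `g` is the image under `pull σ` of the identity generator at the
`n`-simplex `g ∘ σ`. With `barDesc`, this says that `barObj` is free on the identity generators, one
for each `n`-simplex of `C`. -/
theorem barObj_hom_ext {n : SimplexCategory} {M : SimplexCat C ⥤ AddCommGrpCat.{w}}
    {a b : barObj C n ⟶ M} (h : ∀ f : Fin (n.len + 1) ⥤ C,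
      a.app ⟨n, f⟩ (barGen (g := ⟨n, f⟩) (𝟙 n)) = b.app ⟨n, f⟩ (barGen (g := ⟨n, f⟩) (𝟙 n))) :
    a = b := by
  refine NatTrans.ext (funext fun g => barObj_obj_hom_ext fun σ => ?_)
  have key : ∀ e : barObj C n ⟶ M, e.app g (barGen σ) =
      M.map (SimplexCat.pull σ g.simplex) (e.app ⟨n, toFunctor σ ⋙ g.simplex⟩
        (barGen (g := ⟨n, toFunctor σ ⋙ g.simplex⟩) (𝟙 n))) := fun e => by
    refine Eq.trans ?_ (ConcreteCategory.congr_hom (e.naturality (SimplexCat.pull σ g.simplex))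
      (barGen (g := ⟨n, toFunctor σ ⋙ g.simplex⟩) (𝟙 n)))
    refine congrArg (e.app g) (Eq.symm ?_)
    exact (barObj_map_gen (SimplexCat.pull σ g.simplex) (𝟙 n)).trans
      (congrArg barGen (Category.id_comp σ))
  rw [key a, key b, h]

/-- A free functor is projective: epimorphisms are objectwise surjective, so the images of the
identity generators can be lifted one by one. -/
instance (n : SimplexCategory) : Projective (barObj C n) where
  factors {E X} f e _ := by
    have he : ∀ c, Function.Surjective (e.app c) := fun c =>
      (AddCommGrpCat.epi_iff_surjective _).1 inferInstance
    choose y hy using fun f₀ : Fin (n.len + 1) ⥤ C =>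
      he ⟨n, f₀⟩ (f.app ⟨n, f₀⟩ (barGen (g := ⟨n, f₀⟩) (𝟙 n)))
    refine ⟨barDesc E y, barObj_hom_ext fun f₀ => ?_⟩
    exact (congrArg (e.app _) (barDesc_gen_id E y f₀)).trans (hy f₀)

/-- The morphism of `barObj` given by precomposition. -/
def barMap {n m : SimplexCategory} (ρ : m ⟶ n) : barObj C n ⟶ barObj C m where
  app g := AddCommGrpCat.ofHom (FreeAbelianGroup.map fun σ => ULift.up (ρ ≫ σ.down))
  naturality g g' s := by
    refine barObj_obj_hom_ext fun σ => ?_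
    refine (congrArg (FreeAbelianGroup.map _) (barObj_map_gen s σ)).trans ?_
    refine (FreeAbelianGroup.map_of_apply _).trans (Eq.symm ?_)
    refine (congrArg ((barObj C m).map s) (FreeAbelianGroup.map_of_apply _)).trans ?_
    refine (barObj_map_gen s (ρ ≫ σ)).trans ?_
    exact congrArg barGen (Category.assoc _ _ _)

theorem barMap_gen {n m : SimplexCategory} (ρ : m ⟶ n) (g : SimplexCat C) (σ : n ⟶ g.dim) :
    (barMap ρ).app g (barGen σ) = barGen (ρ ≫ σ) :=
  FreeAbelianGroup.map_of_apply _

variable (C) in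
/-- The simplicial object of the functors `barObj`. -/
def barSimplicial : SimplicialObject (SimplexCat C ⥤ AddCommGrpCat.{w}) where
  obj n := barObj C n.unop
  map ρ := barMap ρ.unop
  map_id n := by
    ext g : 2
    refine barObj_obj_hom_ext fun σ => ?_
    exact (barMap_gen _ g σ).trans (congrArg barGen (Category.id_comp σ))
  map_comp ρ ρ' := by
    ext g : 2
    refine barObj_obj_hom_ext fun σ => ?_
    refine (barMap_gen _ g σ).trans (Eq.symm ?_)
    refine (congrArg ((barMap ρ'.unop).app g) (barMap_gen ρ.unop g σ)).trans ?_
    exact (barMap_gen _ g _).trans (congrArg barGen (Category.assoc _ _ _).symm)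

/-- The augmentation of `barObj`, which sends the generators to `1`. -/
def barAug (n : SimplexCategory) : barObj C n ⟶ constZ (SimplexCat C) where
  app g := AddCommGrpCat.ofHom (FreeAbelianGroup.lift fun _ => ULift.up 1)
  naturality g g' s := by
    refine barObj_obj_hom_ext fun σ => ?_
    refine (congrArg (FreeAbelianGroup.lift _) (barObj_map_gen s σ)).trans ?_
    exact (FreeAbelianGroup.lift_apply_of _ _).trans (FreeAbelianGroup.lift_apply_of _ _).symm

theorem barAug_gen {n : SimplexCategory} (g : SimplexCat C) (σ : n ⟶ g.dim) :
    (barAug n).app g (barGen σ) = ULift.up.{w} (1 : ℤ) :=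
  FreeAbelianGroup.lift_apply_of _ _

variable (C) in
/-- The augmented simplicial object of the functors `barObj`. -/
def barAugmented : SimplicialObject.Augmented (SimplexCat C ⥤ AddCommGrpCat.{w}) where
  left := barSimplicial C
  right := constZ (SimplexCat C)
  hom :=
    { app := fun n => barAug n.unop
      naturality := fun n m ρ => by
        ext g : 2
        refine barObj_obj_hom_ext fun σ => ?_
        refine (congrArg ((barAug m.unop).app g) (barMap_gen ρ.unop g σ)).trans ?_
        exact (barAug_gen g _).trans (barAug_gen g σ).symm }

/-- The extra degeneracy on the values of `barObj`. -/
def barShift (n : ℕ) (g : SimplexCat C) :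
    (barObj C ⦋n⦌).obj g ⟶ (barObj C ⦋n + 1⦌).obj g :=
  AddCommGrpCat.ofHom (FreeAbelianGroup.map fun σ => ULift.up (shift σ.down))

theorem barShift_gen {n : ℕ} (g : SimplexCat C) (σ : ⦋n⦌ ⟶ g.dim) :
    barShift n g (barGen σ) = barGen (shift σ) :=
  FreeAbelianGroup.map_of_apply _

/-- The section of the augmentation on the values of `barObj`. -/
def barSection (g : SimplexCat C) :
    AddCommGrpCat.of (ULift.{w} ℤ) ⟶ (barObj C ⦋0⦌).obj g :=
  AddCommGrpCat.ofHom ((zmultiplesHom ((barObj C ⦋0⦌).obj g)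
    (barGen (SimplexCategory.const ⦋0⦌ g.dim 0))).comp AddEquiv.ulift.toAddMonoidHom)

theorem barSection_one (g : SimplexCat C) :
    barSection g (ULift.up.{w} (1 : ℤ)) = barGen (SimplexCategory.const ⦋0⦌ g.dim 0) :=
  one_zsmul _

/-- The common form of the extra degeneracy identities that start with `barShift`: each reduces to
an identity for `shift` on generators. -/
theorem barMap_shift {n k : ℕ} (g : SimplexCat C) (ρ' : ⦋k⦌ ⟶ ⦋n + 1⦌)
    (x : (barObj C ⦋n⦌).obj g ⟶ (barObj C ⦋k⦌).obj g)
    (h : ∀ σ : ⦋n⦌ ⟶ g.dim, x (barGen σ) = barGen (ρ' ≫ shift σ)) :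
    barShift n g ≫ (barMap ρ').app g = x := by
  refine barObj_obj_hom_ext fun σ => ?_
  refine (congrArg ((barMap ρ').app g) (barShift_gen g σ)).trans ?_
  exact (barMap_gen ρ' g _).trans (h σ).symm

theorem σ_succ_comp_shift {n : ℕ} {Δ : SimplexCategory} (τ : ⦋n⦌ ⟶ Δ) (i : Fin (n + 1)) :
    SimplexCategory.σ i.succ ≫ shift τ = shift (SimplexCategory.σ i ≫ τ) := by
  ext j : 3
  cases j using Fin.cases with
  | zero => rfl
  | succ j =>
    change shiftFun _ (i.succ.predAbove j.succ) = τ.toOrderHom (i.predAbove j)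
    rw [Fin.succ_predAbove_succ, shiftFun_succ]

/-- The extra degeneracy of the values of `barAugmented`. -/
def barExtraDegeneracy (g : SimplexCat C) :
    SimplicialObject.Augmented.ExtraDegeneracy
      (((SimplicialObject.Augmented.whiskering _ _).obj ((evaluation _ _).obj g)).obj
        (barAugmented C)) where
  s' := barSection g
  s n := barShift n g
  s'_comp_ε := by
    refine AddCommGrpCat.hom_ext (AddMonoidHom.ext fun x => ?_)
    change (barAug ⦋0⦌).app g (barSection g x) = x
    obtain ⟨x⟩ := x
    have h : (barAug ⦋0⦌).app g (barSection g (ULift.up.{w} (1 : ℤ))) = ULift.up.{w} (1 : ℤ) :=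
      (congrArg ((barAug ⦋0⦌).app g) (barSection_one g)).trans (barAug_gen g _)
    -- The group is generated by 1, so the identity need only be checked there.
    have e : (ULift.up.{w} x : ULift.{w} ℤ) = x • ULift.up.{w} (1 : ℤ) :=
      ULift.ext _ _ (by simp)
    rw [e, map_zsmul, map_zsmul]
    exact congrArg (x • ·) h
  s₀_comp_δ₁ := by
    refine barMap_shift g _ _ fun σ => ?_
    refine (congrArg (barSection g) (barAug_gen g σ)).trans ((barSection_one g).trans ?_)
    refine congrArg barGen ?_
    ext i : 3
    fin_cases i
    rfl
  s_comp_δ₀ n := barMap_shift g _ _ fun σ => congrArg barGen (δ_zero_comp_shift σ).symm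
  s_comp_δ n i := barMap_shift g _ _ fun σ =>
    (congrArg (barShift n g) (barMap_gen (SimplexCategory.δ i) g σ)).trans
      ((barShift_gen g _).trans (congrArg barGen (δ_succ_comp_shift σ i).symm))
  s_comp_σ n i := barMap_shift g _ _ fun σ =>
    (congrArg (barShift (n + 1) g) (barMap_gen (SimplexCategory.σ i) g σ)).trans
      ((barShift_gen g _).trans (congrArg barGen (σ_succ_comp_shift σ i).symm))

variable (C) in
/-- The chain complex of the functors `barObj`. -/
abbrev barComplex : ChainComplex (SimplexCat C ⥤ AddCommGrpCat.{w}) ℕ :=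
  AlgebraicTopology.AlternatingFaceMapComplex.obj (barSimplicial C)

variable (C) in
/-- The augmentation of the bar complex. -/
def barπ : barComplex C ⟶ (ChainComplex.single₀ _).obj (constZ (SimplexCat C)) :=
  AlgebraicTopology.AlternatingFaceMapComplex.ε.app (barAugmented C)

theorem barπ_f_zero : (barπ C).f 0 = barAug ⦋0⦌ :=
  AlgebraicTopology.AlternatingFaceMapComplex.ε_app_f_zero _

/-- Quasi-isomorphisms of functors are detected objectwise. At `g` the augmented object is that of
the chains of `Δ[dim g]`, and its extra degeneracy makes the augmentation a homotopy equivalence. -/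
instance : QuasiIso (barπ C) := by
  rw [HomologicalComplex.quasiIso_iff_evaluation]
  intro g
  let E := (evaluation (SimplexCat C) AddCommGrpCat.{w}).obj g
  let X := ((SimplicialObject.Augmented.whiskering _ _).obj E).obj (barAugmented C)
  -- Evaluation at `g` commutes with forming the alternating complex because it is additive: the
  -- terms agree on the nose and the differentials agree as sums. The isomorphism `e₂` does the same
  -- for the complex concentrated in degree 0.
  let e₁ : (E.mapHomologicalComplex (ComplexShape.down ℕ)).obj (barComplex C) ≅
      AlgebraicTopology.AlternatingFaceMapComplex.obj (SimplicialObject.Augmented.drop.obj X) :=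
    HomologicalComplex.Hom.isoOfComponents (fun _ => Iso.refl _) (by
      rintro _ j rfl
      refine (Category.id_comp _).trans (Eq.trans ?_ (Category.comp_id _).symm)
      refine (AlgebraicTopology.AlternatingFaceMapComplex.obj_d_eq _ j).trans ?_
      refine Eq.trans ?_ (congrArg E.map
        (AlgebraicTopology.AlternatingFaceMapComplex.obj_d_eq (barSimplicial C) j)).symm
      rw [Functor.map_sum]
      refine Finset.sum_congr rfl fun i _ => ?_
      rw [Functor.map_zsmul]
      rfl)
  let e₂ : (E.mapHomologicalComplex (ComplexShape.down ℕ)).obj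
      ((ChainComplex.single₀ _).obj (constZ (SimplexCat C))) ≅
      (ChainComplex.single₀ _).obj (SimplicialObject.Augmented.point.obj X) :=
    (HomologicalComplex.singleMapHomologicalComplex E (ComplexShape.down ℕ) 0).app
      (constZ (SimplexCat C))
  let φ : AlgebraicTopology.AlternatingFaceMapComplex.obj
      (SimplicialObject.Augmented.drop.obj X) ⟶
      (ChainComplex.single₀ _).obj (SimplicialObject.Augmented.point.obj X) :=
    AlgebraicTopology.AlternatingFaceMapComplex.ε.app X
  have hφ : QuasiIso φ := (barExtraDegeneracy g).homotopyEquiv.quasiIso_hom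
  have h : (E.mapHomologicalComplex (ComplexShape.down ℕ)).map (barπ C) =
      e₁.hom ≫ φ ≫ e₂.inv := by
    rw [← Category.assoc, Iso.eq_comp_inv]
    refine HomologicalComplex.to_single_hom_ext ?_
    have h₂ : e₂.hom.f 0 = 𝟙 _ :=
      HomologicalComplex.singleMapHomologicalComplex_hom_app_self E (ComplexShape.down ℕ) 0 _
    refine (congrArg (((E.mapHomologicalComplex (ComplexShape.down ℕ)).map (barπ C)).f 0 ≫ ·)
      h₂).trans ((Category.comp_id _).trans ?_)
    refine (congrArg (fun γ => γ.app g) barπ_f_zero).trans (Eq.symm ?_)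
    exact (Category.id_comp _).trans
      (AlgebraicTopology.AlternatingFaceMapComplex.ε_app_f_zero X)
  change QuasiIso ((E.mapHomologicalComplex (ComplexShape.down ℕ)).map (barπ C))
  rw [h]
  have : QuasiIso (φ ≫ e₂.inv) := inferInstance
  infer_instance

variable (C) in
/-- The bar resolution of the constant functor `ℤ` on the simplex category of `C`. -/
def barResolution : ProjectiveResolution (constZ (SimplexCat C)) where
  complex := barComplex C
  projective n := inferInstanceAs (Projective (barObj C ⦋n⦌))
  π := barπ C
  quasiIso := inferInstance

end Bar

/-! ### The differential and the naturality of the bar resolution. -/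

section BarDifferential

open Simplicial

theorem barComplex_d_app {C : Type w} [SmallCategory C] (n : ℕ) (g : SimplexCat C) :
    ((barComplex C).d (n + 1) n).app g =
      ∑ i : Fin (n + 2), (-1 : ℤ) ^ (i : ℕ) •
        (barMap (SimplexCategory.δ i) : barObj C ⦋n + 1⦌ ⟶ barObj C ⦋n⦌).app g := by
  let E := (evaluation (SimplexCat C) AddCommGrpCat.{w}).obj g
  refine (congrArg E.map
    (AlgebraicTopology.AlternatingFaceMapComplex.obj_d_eq (barSimplicial C) n)).trans ?_
  rw [Functor.map_sum]
  exact Finset.sum_congr rfl fun i _ => Functor.map_zsmul _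

/-- Writes each face of the identity generator as the pushforward of the identity generator of a
face of `f`. In this form, evaluating a natural family on it yields the Thomason differential. -/
theorem barComplex_d_gen {C : Type w} [SmallCategory C] (n : ℕ) (f : Fin (n + 1 + 1) ⥤ C) :
    ((barComplex C).d (n + 1) n).app ⟨⦋n + 1⦌, f⟩ (barGen (g := ⟨⦋n + 1⦌, f⟩) (𝟙 ⦋n + 1⦌)) =
      ∑ i : Fin (n + 2), (-1 : ℤ) ^ (i : ℕ) •
        (barObj C ⦋n⦌).map (SimplexCat.pull (SimplexCategory.δ i) f)
          (barGen (g := ⟨⦋n⦌, toFunctor (SimplexCategory.δ i) ⋙ f⟩) (𝟙 ⦋n⦌)) := by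
  refine (ConcreteCategory.congr_hom (barComplex_d_app n ⟨⦋n + 1⦌, f⟩) _).trans ?_
  let ev : ((barObj C ⦋n + 1⦌).obj ⟨⦋n + 1⦌, f⟩ ⟶ (barObj C ⦋n⦌).obj ⟨⦋n + 1⦌, f⟩) →+
      (barObj C ⦋n⦌).obj ⟨⦋n + 1⦌, f⟩ :=
    AddMonoidHom.mk' (fun γ => γ (barGen (g := ⟨⦋n + 1⦌, f⟩) (𝟙 ⦋n + 1⦌))) fun _ _ => rfl
  refine (map_sum ev _ _).trans (Finset.sum_congr rfl fun i _ => ?_)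
  refine (map_zsmul ev _ _).trans (congrArg _ ?_)
  refine (barMap_gen (SimplexCategory.δ i) ⟨⦋n + 1⦌, f⟩ (𝟙 _)).trans (Eq.symm ?_)
  refine (barObj_map_gen (SimplexCat.pull (SimplexCategory.δ i) f) (𝟙 ⦋n⦌)).trans ?_
  exact congrArg barGen ((Category.id_comp _).trans (Category.comp_id _).symm)

variable {A : Type u} [Category.{w} A]

/-- The bar complexes are compatible with restriction. -/
def barComparison {S T : NatSystem A} (a : S ⟶ T) :
    barComplex T.base ⟶ restrict (SimplexCat.mapFunctor a.functor) (barComplex S.base) where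
  f n :=
    -- The value of `barObj` at `g` depends only on `g.dim`, which `Δ/φ` leaves unchanged, so the
    -- comparison can be the identity.
    { app := fun g => 𝟙 ((barObj T.base ⦋n⦌).obj g)
      naturality := fun g g' s => (𝟙 (barObj T.base ⦋n⦌) : _ ⟶ _).naturality s }
  comm' := by
    rintro _ n rfl
    ext g : 2
    refine (Category.id_comp _).trans (Eq.trans ?_ (Category.comp_id _).symm)
    exact (barComplex_d_app n ((SimplexCat.mapFunctor a.functor).obj g)).trans
      (barComplex_d_app n g).symm

/-- Hence the functoriality of Ext may be computed on bar resolutions with this strict comparison in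
place of a chosen lift. -/
theorem isComparison_bar {S T : NatSystem A} (a : S ⟶ T) :
    IsComparison (SimplexCat.mapFunctor a.functor) (barResolution S.base) (barResolution T.base)
      (barComparison a) := by
  refine NatTrans.ext (funext fun g => ?_)
  refine (Category.id_comp _).trans (Eq.trans ?_ (Category.comp_id _).symm)
  exact (congrArg (fun γ => NatTrans.app γ ((SimplexCat.mapFunctor a.functor).obj g))
    barπ_f_zero).trans (congrArg (fun γ => NatTrans.app γ g) barπ_f_zero).symm

end BarDifferential

/-! ### Symbolic homs out of the bar resolution are Thomason cochains. -/

section BarCochains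

open Simplicial

variable {A : Type u} [Category.{w} A] [Abelian A] [HasLimits A]

/-- Under the adjunction, a morphism into the symbolic hom is a natural transformation out of
`barObj`, and that is determined on the identity generators. -/
theorem symHom_bar_ext {C : Type w} [SmallCategory C] (T : SimplexCat C ⥤ A)
    {n : SimplexCategory} {X : A} {x y : X ⟶ (symHom T).obj (op (barObj C n))}
    (h : ∀ f : Fin (n.len + 1) ⥤ C,
      x ≫ symEval T (barObj C n) ⟨n, f⟩ (barGen (g := ⟨n, f⟩) (𝟙 n)) =
        y ≫ symEval T (barObj C n) ⟨n, f⟩ (barGen (g := ⟨n, f⟩) (𝟙 n))) : x = y := by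
  apply ((symHomAdj T).homEquiv X (op (barObj C n))).symm.injective
  rw [Adjunction.homEquiv_counit, Adjunction.homEquiv_counit]
  exact Quiver.Hom.unop_inj (barObj_hom_ext h)

variable (S : NatSystem A)

/-- The symbolic homs out of the bar resolution are the Thomason cochains. -/
def barCochainIso (n : ℕ) :
    (homComplex S.system (barComplex S.base)).X n ≅ ((thomasonComplex A).obj S).X n where
  hom := cochainLift S fun f =>
    symEval S.system (barObj S.base ⦋n⦌) ⟨⦋n⦌, f⟩ (barGen (g := ⟨⦋n⦌, f⟩) (𝟙 ⦋n⦌))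
  inv := symLift S.system (barObj S.base ⦋n⦌) _
    (barDesc ((homInto S.system).obj _).unop fun f => cochainπ S f)
  hom_inv_id := by
    refine symHom_bar_ext S.system fun f => ?_
    refine (Category.assoc _ _ _).trans ((congrArg (_ ≫ ·)
      ((symLift_eval _ _ _ _ _ _).trans (barDesc_gen_id _ _ f))).trans ?_)
    exact (cochainLift_π S _ f).trans (Category.id_comp _).symm
  inv_hom_id := by
    refine cochain_ext S fun f => ?_
    refine (Category.assoc _ _ _).trans ((congrArg (_ ≫ ·) (cochainLift_π S _ f)).trans ?_)
    refine (symLift_eval _ _ _ _ _ _).trans ((barDesc_gen_id _ _ f).trans ?_)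
    exact (Category.id_comp _).symm

theorem barCochainIso_hom_π {n : ℕ} (f : Fin (n + 1) ⥤ S.base) :
    (barCochainIso S n).hom ≫ cochainπ S f =
      symEval S.system (barObj S.base ⦋n⦌) ⟨⦋n⦌, f⟩ (barGen (g := ⟨⦋n⦌, f⟩) (𝟙 ⦋n⦌)) :=
  cochainLift_π S _ f

/-- The symbolic hom complex of the bar resolution is the Thomason complex. -/
def barHomComplexIso :
    homComplex S.system (barComplex S.base) ≅ (thomasonComplex A).obj S :=
  HomologicalComplex.Hom.isoOfComponents (barCochainIso S) (by
    rintro n _ rfl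
    refine cochain_ext S fun f => ?_
    refine (Category.assoc _ _ _).trans ((congrArg (_ ≫ ·) (thomasonComplex_d_π S f)).trans ?_)
    refine Eq.symm ((Category.assoc _ _ _).trans
      ((congrArg (_ ≫ ·) (barCochainIso_hom_π S f)).trans ?_))
    refine (symHom_map_eval S.system ((barComplex S.base).d (n + 1) n) _ _).trans ?_
    refine (congrArg (symEval S.system (barObj S.base ⦋n⦌) _) (barComplex_d_gen n f)).trans ?_
    -- Evaluation is additive in the element, so it can be distributed over the alternating sum of
    -- faces.
    let ev : (barObj S.base ⦋n⦌).obj ⟨⦋n + 1⦌, f⟩ →+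
        ((symHom S.system).obj (op (barObj S.base ⦋n⦌)) ⟶ S.system.obj ⟨⦋n + 1⦌, f⟩) :=
      AddMonoidHom.mk' (symEval S.system (barObj S.base ⦋n⦌) ⟨⦋n + 1⦌, f⟩)
        (symEval_add _ _ _)
    refine (map_sum ev _ _).trans (Eq.trans ?_ (Preadditive.comp_sum _ _ _).symm)
    refine Finset.sum_congr rfl fun i _ => ?_
    refine (map_zsmul ev _ _).trans (Eq.trans ?_ (Preadditive.comp_zsmul _ _ _).symm)
    refine congrArg _ ?_
    refine (symEval_map S.system (barObj S.base ⦋n⦌) _ _).trans ?_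
    refine Eq.symm ((Category.assoc _ _ _).symm.trans ?_)
    exact congrArg (· ≫ _) (barCochainIso_hom_π S _))

theorem barHomComplexIso_naturality {S T : NatSystem A} (a : S ⟶ T) :
    homComplexMap (SimplexCat.mapFunctor a.functor) a.trans (barComparison a) ≫
        (barHomComplexIso T).hom = (barHomComplexIso S).hom ≫ (thomasonComplex A).map a := by
  ext n
  refine cochain_ext T fun f => ?_
  refine (Category.assoc _ _ _).trans ((congrArg (_ ≫ ·) (barCochainIso_hom_π T f)).trans ?_)
  refine (symMap_eval _ _ _ _ _).trans (Eq.symm ?_)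
  refine (Category.assoc _ _ _).trans ((congrArg (_ ≫ ·) (thomasonComplex_map_f_π a f)).trans ?_)
  refine (Category.assoc _ _ _).symm.trans ?_
  exact congrArg (· ≫ _) (barCochainIso_hom_π S _)

end BarCochains

/-! ### Independence of the projective resolution. -/

section ChangeOfResolution

variable {A : Type u} [Category.{w} A] [Abelian A] [HasLimits A]

/-- The morphism on cohomology induced by a morphism of natural systems, for any choice of the
resolutions. -/
def resolutionMap {S T : NatSystem A} (a : S ⟶ T)
    (P : ProjectiveResolution (constZ (SimplexCat S.base)))
    (Q : ProjectiveResolution (constZ (SimplexCat T.base))) (n : ℕ) :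
    (homComplex S.system P.complex).homology n ⟶ (homComplex T.system Q.complex).homology n :=
  HomologicalComplex.homologyMap (homComplexMap (SimplexCat.mapFunctor a.functor) a.trans
    (exists_isOver Q (restrictRes (SimplexCat.mapFunctor a.functor) P)
      (𝟙 (constZ (SimplexCat T.base)))).choose) n

theorem resolutionMap_eq {S T : NatSystem A} (a : S ⟶ T)
    {P : ProjectiveResolution (constZ (SimplexCat S.base))}
    {Q : ProjectiveResolution (constZ (SimplexCat T.base))}
    {α : Q.complex ⟶ restrict (SimplexCat.mapFunctor a.functor) P.complex}
    (hα : IsComparison _ P Q α) (n : ℕ) :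
    resolutionMap a P Q n = HomologicalComplex.homologyMap (homComplexMap _ a.trans α) n :=
  homologyMap_homComplexMap_eq _ _ (exists_isOver Q
    (restrictRes (SimplexCat.mapFunctor a.functor) P) (𝟙 _)).choose_spec hα n

theorem resolutionMap_id (S : NatSystem A)
    (P : ProjectiveResolution (constZ (SimplexCat S.base))) (n : ℕ) :
    resolutionMap (𝟙 S) P P n = 𝟙 _ := by
  rw [resolutionMap_eq (𝟙 S) (isComparison_id S P), homComplexMap_id,
    HomologicalComplex.homologyMap_id]

/-- A composite of comparison maps is again a comparison map, and all comparison maps agree on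
cohomology. Taking `a` or `b` to be an identity gives the compatibility with a change of resolution.
-/
theorem resolutionMap_comp {R S T : NatSystem A} (a : R ⟶ S) (b : S ⟶ T)
    (P : ProjectiveResolution (constZ (SimplexCat R.base)))
    (Q : ProjectiveResolution (constZ (SimplexCat S.base)))
    (Q' : ProjectiveResolution (constZ (SimplexCat T.base))) (n : ℕ) :
    resolutionMap a P Q n ≫ resolutionMap b Q Q' n = resolutionMap (a ≫ b) P Q' n := by
  obtain ⟨α, hα⟩ := exists_isOver Q (restrictRes (SimplexCat.mapFunctor a.functor) P) (𝟙 _)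
  obtain ⟨β, hβ⟩ := exists_isOver Q' (restrictRes (SimplexCat.mapFunctor b.functor) Q) (𝟙 _)
  rw [resolutionMap_eq a hα, resolutionMap_eq b hβ,
    resolutionMap_eq (a ≫ b) (isComparison_comp a b hα hβ)]
  refine (HomologicalComplex.homologyMap_comp _ _ _).symm.trans ?_
  exact congrArg (fun γ => HomologicalComplex.homologyMap γ n) (homComplexMap_comp a b α β).symm

/-- The cohomology is independent of the resolution. -/
def resolutionIso (S : NatSystem A) (P Q : ProjectiveResolution (constZ (SimplexCat S.base)))
    (n : ℕ) :
    (homComplex S.system P.complex).homology n ≅ (homComplex S.system Q.complex).homology n where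
  hom := resolutionMap (𝟙 S) P Q n
  inv := resolutionMap (𝟙 S) Q P n
  hom_inv_id := by rw [resolutionMap_comp, Category.comp_id, resolutionMap_id]
  inv_hom_id := by rw [resolutionMap_comp, Category.comp_id, resolutionMap_id]

variable (A) in
/-- The Ext groups of the constant functor `ℤ` are the Thomason cohomology. -/
def extIsoThomason (n : ℕ) : extFunctor A n ≅ thomasonCohomology A n :=
  NatIso.ofComponents
    (fun S => resolutionIso S (projectiveResolution (constZ (SimplexCat S.base)))
      (barResolution S.base) n ≪≫
        (HomologicalComplex.homologyFunctor A _ n).mapIso (barHomComplexIso S))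
    fun {S T} a => by
      -- The naturality square is pasted from `h`, where both paths equal `resolutionMap a` from the
      -- chosen resolution to the bar resolution, and `h'`, which lives entirely on bar resolutions.
      have h : resolutionMap a (projectiveResolution _) (projectiveResolution _) n ≫
          resolutionMap (𝟙 T) (projectiveResolution _) (barResolution T.base) n =
          resolutionMap (𝟙 S) (projectiveResolution _) (barResolution S.base) n ≫
            resolutionMap a (barResolution S.base) (barResolution T.base) n := by
        rw [resolutionMap_comp, resolutionMap_comp, Category.comp_id, Category.id_comp]
      have h' : resolutionMap a (barResolution S.base) (barResolution T.base) n ≫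
          HomologicalComplex.homologyMap (barHomComplexIso T).hom n =
          HomologicalComplex.homologyMap (barHomComplexIso S).hom n ≫
            (thomasonCohomology A n).map a := by
        rw [resolutionMap_eq a (isComparison_bar a)]
        refine (HomologicalComplex.homologyMap_comp _ _ _).symm.trans ?_
        refine (congrArg (fun γ => HomologicalComplex.homologyMap γ n)
          (barHomComplexIso_naturality a)).trans ?_
        exact HomologicalComplex.homologyMap_comp _ _ _
      refine (Category.assoc _ _ _).symm.trans ((congrArg (· ≫ _) h).trans ?_)
      refine (Category.assoc _ _ _).trans ((congrArg (_ ≫ ·) h').trans ?_)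
      exact (Category.assoc _ _ _).symm

end ChangeOfResolution

end Thomason

end

theorem mainTheorem1 {A : Type u} [Category.{w} A] [Abelian A] [HasLimits A] [AB4Star A] :
    (∀ n : ℕ, Nonempty (Thomason.thomasonCohomology A n ≅ Thomason.extFunctor A n)) ∧
    Nonempty (Thomason.DerivedLimits A) ∧
    ∀ (L : Thomason.DerivedLimits A) (n : ℕ),
      Nonempty (Thomason.extFunctor A n ≅ L.functor n) :=
  ⟨fun n => ⟨(Thomason.extIsoThomason A n).symm⟩,
    -- Thomason cohomology itself witnesses the existence of the derived limits, and the comparison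
    -- of Ext with an arbitrary choice `L` passes through it.
    ⟨fun C => Thomason.thomasonRightDerived A C⟩,
    fun L n => ⟨Thomason.extIsoThomason A n ≪≫ Thomason.thomasonIsoDerivedLimits L n⟩⟩
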